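/- Let $p,q\ge 1$ be coprime integers, let $G=\langle x,y\mid x^p=y^q\rangle$ be the group of the $(p,q)$-torus knot, and let $\alpha:G\to\langle t\rangle\cong\mathbb Z$ be its abelianization, $\alpha(x)=t^q$, $\alpha(y)=t^p$. For a representation $\rho:G\to SL(2,\mathbb C)$ let $\Phi:\mathbb Z F(x,y)\to M(2;\mathbb C[t,t^{-1}])$ be the ring homomorphism with $\Phi(g)=\alpha(g)\rho(g)$, let $r=x^py^{-q}$, and let $\partial/\partial x,\partial/\partial y$ be Fox's free differentials. The twisted Alexander polynomial of $\rho$ (computed from this presentation) is $$\Delta_\rho(t)=\frac{\det\Phi(\partial r/\partial x)}{\det\Phi(y-1)}=\frac{\det\Phi(\partial r/\partial y)}{\det\Phi(x-1)}\in\mathbb C(t).$$ Let $\mathcal R$ be the space of $SL(2,\mathbb C)$-conjugacy classes of irreducible representations $\rho:G\to SL(2,\mathbb C)$, with the quotient of the topology of pointwise convergence. **Theorem (Kitano–Morifuji).** 1. For every irreducible $\rho$ there is exactly one pair of integers $(a,b)$ with $0<a<p$, $0<b<q$ such that $\lambda=e^{\sqrt{-1}\pi a/p}$ is an eigenvalue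 of $\rho(x)$ and $\mu=e^{\sqrt{-1}\pi b/q}$ is an eigenvalue of $\rho(y)$; moreover $a\equiv b \pmod 2$. Both denominators $\det\Phi(y-1)$, $\det\Phi(x-1)$ are non-zero, both quotients above agree, and $$\Delta_\rho(t)=\frac{\Bigl(\sum_{i=0}^{p-1}\lambda^{i}t^{iq}\Bigr)\Bigl(\sum_{i=0}^{p-1}\lambda^{-i}t^{iq}\Bigr)}{1-(\mu+\mu^{-1})t^{p}+t^{2p}} .$$ 2. The connected components of $\mathcal R$ are indexed by the pairs $(a,b)$ with $0<a<p$, $0<b<q$, $a\equiv b\pmod 2$: every such pair occurs, and two classes lie in the same connected component if and only if they have the same pair. 3. $\Delta_\rho(t)$ depends only on the conjugacy class of $\rho$, and the resulting function $\mathcal R\to\mathbb C(t)$ is locally constant; it is constant on each connected component of $\mathcal R$. -/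

import Mathlib

open scoped LaurentPolynomial

noncomputable section

/-! ### Fox's free differentials -/

/-- The affine permutation `m ↦ δᵢⱼ + xᵢ m` of `ℤF`, where `F` is the free group on `ι`. -/
def foxStep {ι : Type} [DecidableEq ι] (j i : ι) :
    Equiv.Perm (MonoidAlgebra ℤ (FreeGroup ι)) where
  toFun m := (if i = j then 1 else 0) + MonoidAlgebra.of ℤ _ (FreeGroup.of i) * m
  invFun m := MonoidAlgebra.of ℤ _ (FreeGroup.of i)⁻¹ * (m - (if i = j then 1 else 0))
  left_inv m := by
    dsimp only
    rw [add_sub_cancel_left, ← mul_assoc, ← map_mul, inv_mul_cancel, map_one, one_mul]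
  right_inv m := by
    dsimp only
    rw [← mul_assoc, ← map_mul, mul_inv_cancel, map_one, one_mul, add_sub_cancel]

/-- The free differential `∂g/∂xⱼ` of an element `g` of the free group: the element `g` acts on
`ℤF` by the affine map `m ↦ ∂g/∂xⱼ + g m`, so that `∂g/∂xⱼ` is the image of `0`. -/
def foxWord {ι : Type} [DecidableEq ι] (j : ι) (g : FreeGroup ι) :
    MonoidAlgebra ℤ (FreeGroup ι) :=
  FreeGroup.lift (foxStep j) g 0

/-- Fox's free differential `∂/∂xⱼ : ℤF → ℤF`, the additive extension of `foxWord`. -/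
def foxDeriv {ι : Type} [DecidableEq ι] (j : ι) :
    MonoidAlgebra ℤ (FreeGroup ι) →+ MonoidAlgebra ℤ (FreeGroup ι) :=
  MonoidAlgebra.liftNC (Int.castAddHom (MonoidAlgebra ℤ (FreeGroup ι))) (foxWord j)

theorem foxStep_lift_apply {ι : Type} [DecidableEq ι] (j : ι) (g : FreeGroup ι)
    (m : MonoidAlgebra ℤ (FreeGroup ι)) :
    FreeGroup.lift (foxStep j) g m = foxWord j g + MonoidAlgebra.of ℤ _ g * m := by
  induction g using FreeGroup.induction_on generalizing m with
  | C1 => simp [foxWord, ← MonoidAlgebra.one_def]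
  | of i => simp [foxWord, foxStep]
  | inv_of i _ =>
    simp only [foxWord, map_inv, FreeGroup.lift_apply_of]
    simp only [foxStep, Equiv.Perm.inv_def, Equiv.symm, Equiv.coe_fn_mk, mul_sub, mul_zero]
    abel
  | mul x y hx hy =>
    have h0 : foxWord j (x * y) = foxWord j x + MonoidAlgebra.of ℤ _ x * foxWord j y := by
      simp only [foxWord, map_mul, Equiv.Perm.mul_apply]
      rw [hx]; rfl
    rw [h0, map_mul, Equiv.Perm.mul_apply, hy, hx, map_mul, mul_add, mul_assoc, add_assoc]

theorem foxDeriv_of {ι : Type} [DecidableEq ι] (j : ι) (g : FreeGroup ι) :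
    foxDeriv j (MonoidAlgebra.of ℤ _ g) = foxWord j g := by
  simp [foxDeriv, MonoidAlgebra.of_apply]

/-- `∂xᵢ/∂xⱼ = δᵢⱼ`. -/
theorem foxDeriv_generator {ι : Type} [DecidableEq ι] (j i : ι) :
    foxDeriv j (MonoidAlgebra.of ℤ _ (FreeGroup.of i)) = if i = j then 1 else 0 := by
  rw [foxDeriv_of]; simp [foxWord, foxStep]

/-- `∂(gh)/∂xⱼ = ∂g/∂xⱼ + g ∂h/∂xⱼ`. -/
theorem foxDeriv_mul {ι : Type} [DecidableEq ι] (j : ι) (g h : FreeGroup ι) :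
    foxDeriv j (MonoidAlgebra.of ℤ _ (g * h)) =
      foxDeriv j (MonoidAlgebra.of ℤ _ g) +
        MonoidAlgebra.of ℤ _ g * foxDeriv j (MonoidAlgebra.of ℤ _ h) := by
  simp only [foxDeriv_of]
  rw [← foxStep_lift_apply]
  simp only [foxWord, map_mul, Equiv.Perm.mul_apply]

/-! ### The twisted Alexander polynomial of a deficiency one presentation -/

section Wada

variable {K : Type} [Field K] {m : ℕ} {r : Fin m → FreeGroup (Fin (m + 1))}

/-- The ring homomorphism `Φ : ℤFₙ → M(2; K[t, t⁻¹])` with `Φ(g) = t ^ α(g) ρ(g)`, for the group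
`⟨x₀, …, xₘ | r₀, …, rₘ₋₁⟩`, a homomorphism `α` to the infinite cyclic group `⟨t⟩` (the integer
`n` stands for `tⁿ`) and a representation `ρ` in `SL(2; K)`. -/
def wadaMap (α : PresentedGroup (Set.range r) →* Multiplicative ℤ)
    (ρ : PresentedGroup (Set.range r) →* Matrix.SpecialLinearGroup (Fin 2) K) :
    MonoidAlgebra ℤ (FreeGroup (Fin (m + 1))) →ₐ[ℤ] Matrix (Fin 2) (Fin 2) K[T;T⁻¹] :=
  MonoidAlgebra.lift ℤ (Matrix (Fin 2) (Fin 2) K[T;T⁻¹]) (FreeGroup (Fin (m + 1)))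
    { toFun := fun g =>
        (LaurentPolynomial.T (α (PresentedGroup.mk _ g)).toAdd : K[T;T⁻¹]) •
          ((ρ (PresentedGroup.mk _ g) : Matrix (Fin 2) (Fin 2) K).map LaurentPolynomial.C)
      map_one' := by simp
      map_mul' := fun g h => by
        rw [map_mul (PresentedGroup.mk _), map_mul α, map_mul ρ, toAdd_mul, LaurentPolynomial.T_add,
          Matrix.SpecialLinearGroup.coe_mul, Matrix.map_mul, smul_mul_smul_comm] }

/-- The twisted Alexander matrix `A_ρ` with its `k`-th (block) column removed, as a matrix of size
`2m × 2m`. -/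
def twistedAlexanderMatrix (α : PresentedGroup (Set.range r) →* Multiplicative ℤ)
    (ρ : PresentedGroup (Set.range r) →* Matrix.SpecialLinearGroup (Fin 2) K)
    (k : Fin (m + 1)) : Matrix (Fin m × Fin 2) (Fin m × Fin 2) K[T;T⁻¹] :=
  Matrix.of fun a b =>
    wadaMap α ρ (foxDeriv (k.succAbove b.1) (MonoidAlgebra.of ℤ _ (r a.1))) a.2 b.2

/-- The Laurent polynomial `det Φ(xₖ - 1)`. -/
def wadaDenominator (α : PresentedGroup (Set.range r) →* Multiplicative ℤ)
    (ρ : PresentedGroup (Set.range r) →* Matrix.SpecialLinearGroup (Fin 2) K)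
    (k : Fin (m + 1)) : K[T;T⁻¹] :=
  (wadaMap α ρ (MonoidAlgebra.of ℤ _ (FreeGroup.of k) - 1)).det

/-- The rational function `det A_{ρ,k} / det Φ(xₖ - 1)`, in the field `K(t)` of fractions
of `K[t, t⁻¹]`. -/
def wadaQuotient (α : PresentedGroup (Set.range r) →* Multiplicative ℤ)
    (ρ : PresentedGroup (Set.range r) →* Matrix.SpecialLinearGroup (Fin 2) K)
    (k : Fin (m + 1)) : FractionRing K[T;T⁻¹] :=
  algebraMap K[T;T⁻¹] (FractionRing K[T;T⁻¹]) (twistedAlexanderMatrix α ρ k).det /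
    algebraMap K[T;T⁻¹] (FractionRing K[T;T⁻¹]) (wadaDenominator α ρ k)

open Classical in
/-- The twisted Alexander polynomial: `det A_{ρ,k} / det Φ(xₖ - 1)` for some `k` with
`det Φ(xₖ - 1) ≠ 0`. -/
def twistedAlexander (α : PresentedGroup (Set.range r) →* Multiplicative ℤ)
    (ρ : PresentedGroup (Set.range r) →* Matrix.SpecialLinearGroup (Fin 2) K) :
    FractionRing K[T;T⁻¹] :=
  if h : ∃ k, wadaDenominator α ρ k ≠ 0 then wadaQuotient α ρ h.choose else 0

end Wada

/-! ### The group of the torus knot and its abelianization -/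

/-- The only relator `x ^ p * y ^ (-q)`, where `x` and `y` are the generators number `0` and `1`. -/
def torusRel (p q : ℕ) : Fin 1 → FreeGroup (Fin 2) :=
  fun _ => FreeGroup.of 0 ^ p * (FreeGroup.of 1 ^ q)⁻¹

/-- The group `⟨x, y | x ^ p = y ^ q⟩` of the `(p, q)`-torus knot. -/
abbrev TorusKnotGroup (p q : ℕ) : Type := PresentedGroup (Set.range (torusRel p q))

/-- The generator `x`. -/
def torusX (p q : ℕ) : TorusKnotGroup p q := PresentedGroup.of 0

/-- The generator `y`. -/
def torusY (p q : ℕ) : TorusKnotGroup p q := PresentedGroup.of 1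

/-- The abelianization `α`, with `α(x) = t ^ q` and `α(y) = t ^ p`. -/
def torusAb (p q : ℕ) : TorusKnotGroup p q →* Multiplicative ℤ :=
  PresentedGroup.toGroup (f := ![Multiplicative.ofAdd (q : ℤ), Multiplicative.ofAdd (p : ℤ)]) <| by
    rintro _ ⟨i, rfl⟩
    apply Multiplicative.toAdd.injective
    simp only [torusRel, map_mul, map_pow, map_inv, FreeGroup.lift_apply_of, Matrix.cons_val_zero,
      Matrix.cons_val_one, toAdd_mul, toAdd_inv, toAdd_pow, toAdd_ofAdd, toAdd_one, nsmul_eq_mul]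
    ring

theorem torusAb_torusX (p q : ℕ) : torusAb p q (torusX p q) = Multiplicative.ofAdd (q : ℤ) :=
  PresentedGroup.toGroup.of _

theorem torusAb_torusY (p q : ℕ) : torusAb p q (torusY p q) = Multiplicative.ofAdd (p : ℤ) :=
  PresentedGroup.toGroup.of _

theorem torusX_pow (p q : ℕ) : torusX p q ^ p = torusY p q ^ q := by
  have h : PresentedGroup.mk (Set.range (torusRel p q)) (torusRel p q 0) = 1 :=
    PresentedGroup.one_of_mem ⟨0, rfl⟩
  rw [torusRel, map_mul, map_inv, mul_inv_eq_one, map_pow, map_pow] at h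
  exact h

theorem torusAb_surjective {p q : ℕ} (hpq : p.Coprime q) :
    Function.Surjective (torusAb p q) := by
  intro n
  have hb : (p : ℤ) * p.gcdA q + q * p.gcdB q = 1 := by
    rw [← Nat.gcd_eq_gcd_ab, hpq.gcd_eq_one]; rfl
  refine ⟨(torusX p q ^ p.gcdB q * torusY p q ^ p.gcdA q) ^ n.toAdd, ?_⟩
  apply Multiplicative.toAdd.injective
  simp only [map_zpow, map_mul, torusAb_torusX, torusAb_torusY, toAdd_zpow, toAdd_mul, smul_eq_mul,
    toAdd_ofAdd]
  linear_combination n.toAdd * hb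

/-- The kernel of `α` is the commutator subgroup, so that `α` is the abelianization. -/
theorem torusAb_ker {p q : ℕ} (hpq : p.Coprime q) :
    (torusAb p q).ker = commutator (TorusKnotGroup p q) := by
  apply le_antisymm
  · intro g hg
    have hb : (p : ℤ) * p.gcdA q + q * p.gcdB q = 1 := by
      rw [← Nat.gcd_eq_gcd_ab, hpq.gcd_eq_one]; rfl
    set X : Abelianization (TorusKnotGroup p q) := Abelianization.of (torusX p q) with hX
    set Y : Abelianization (TorusKnotGroup p q) := Abelianization.of (torusY p q) with hY
    have hXY : X ^ (p : ℤ) = Y ^ (q : ℤ) := by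
      rw [zpow_natCast, zpow_natCast, hX, hY, ← map_pow, ← map_pow, torusX_pow]
    set M := X ^ p.gcdB q * Y ^ p.gcdA q with hM
    have e1 : M ^ (q : ℤ) = X := by
      rw [hM, mul_zpow, ← zpow_mul, ← zpow_mul, mul_comm (p.gcdA q), zpow_mul Y, ← hXY, ← zpow_mul,
        ← zpow_add]
      convert zpow_one X using 2
      linear_combination hb
    have e2 : M ^ (p : ℤ) = Y := by
      rw [hM, mul_zpow, ← zpow_mul, ← zpow_mul, mul_comm (p.gcdB q), zpow_mul X, hXY, ← zpow_mul,
        ← zpow_add]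
      convert zpow_one Y using 2
      linear_combination hb
    have key : (zpowersHom _ M).comp (torusAb p q) = Abelianization.of := by
      apply PresentedGroup.ext
      intro i
      fin_cases i
      · change M ^ (torusAb p q (torusX p q)).toAdd = X
        rw [torusAb_torusX]; exact e1
      · change M ^ (torusAb p q (torusY p q)).toAdd = Y
        rw [torusAb_torusY]; exact e2
    rw [← Abelianization.ker_of, MonoidHom.mem_ker, ← key, MonoidHom.comp_apply,
      MonoidHom.mem_ker.mp hg, map_one]
  · exact Abelianization.commutator_subset_ker _

/-! ### The space of conjugacy classes of irreducible representations -/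

/-- The action of a group on `ℂ²` through a homomorphism to `SL(2; ℂ)`. -/
def standardRep {G : Type} [Group G] (ρ : G →* Matrix.SpecialLinearGroup (Fin 2) ℂ) :
    Representation ℂ G (Fin 2 → ℂ) where
  toFun g := Matrix.toLin' (ρ g : Matrix (Fin 2) (Fin 2) ℂ)
  map_one' := by simp; rfl
  map_mul' g h := by simp [Matrix.toLin'_mul]; rfl

/-- The irreducible representations of `G` in `SL(2; ℂ)`. -/
def IrrepSL2 (G : Type) [Group G] : Type :=
  {ρ : G →* Matrix.SpecialLinearGroup (Fin 2) ℂ // (standardRep ρ).IsIrreducible}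

/-- The topology of pointwise convergence (of the matrix entries). -/
instance irrepTopology (G : Type) [Group G] : TopologicalSpace (IrrepSL2 G) :=
  TopologicalSpace.induced (fun ρ (g : G) => (ρ.1 g : Matrix (Fin 2) (Fin 2) ℂ)) inferInstance

/-- Conjugacy by an element of `SL(2; ℂ)`. -/
instance irrepConj (G : Type) [Group G] : Setoid (IrrepSL2 G) where
  r ρ σ := ∃ P : Matrix.SpecialLinearGroup (Fin 2) ℂ, ∀ g, ρ.1 g = P * σ.1 g * P⁻¹
  iseqv :=
    { refl := fun ρ => ⟨1, fun g => by simp⟩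
      symm := fun {ρ σ} ⟨P, h⟩ => ⟨P⁻¹, fun g => by rw [h]; group⟩
      trans := fun {ρ σ τ} ⟨P, h⟩ ⟨Q, k⟩ => ⟨P * Q, fun g => by rw [h, k]; group⟩ }

/-- The space of conjugacy classes of irreducible representations, with the quotient topology. -/
abbrev IrrepClass (G : Type) [Group G] : Type := Quotient (irrepConj G)

/-! ### The eigenvalues and the rational function -/

/-- The number `e^{√-1 π a / n}`. -/
def rootExp (a n : ℕ) : ℂ := Complex.exp (Complex.I * Real.pi * a / n)

/-- `0 < a < p`, `0 < b < q`, the number `λ = e^{√-1 π a / p}` is an eigenvalue of `ρ(x)` and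
`μ = e^{√-1 π b / q}` is an eigenvalue of `ρ(y)`. As the determinants are `1`, the eigenvalues are
then `λ^{±1}` and `μ^{±1}`. -/
def HasEigenPair {p q : ℕ} (ρ : IrrepSL2 (TorusKnotGroup p q)) (a b : ℕ) : Prop :=
  0 < a ∧ a < p ∧ 0 < b ∧ b < q ∧
    Module.End.HasEigenvalue (standardRep ρ.1 (torusX p q)) (rootExp a p) ∧
    Module.End.HasEigenvalue (standardRep ρ.1 (torusY p q)) (rootExp b q)

/-- `(∑_{i<p} λⁱ t^{iq}) (∑_{i<p} λ⁻ⁱ t^{iq}) / (1 - (μ + μ⁻¹) t^p + t^{2p})`. -/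
def torusFormula (p q : ℕ) (l u : ℂ) : FractionRing ℂ[T;T⁻¹] :=
  algebraMap ℂ[T;T⁻¹] (FractionRing ℂ[T;T⁻¹])
      ((∑ i ∈ Finset.range p, LaurentPolynomial.C (l ^ i) * LaurentPolynomial.T ((i * q : ℕ) : ℤ)) *
        ∑ i ∈ Finset.range p,
          LaurentPolynomial.C (l⁻¹ ^ i) * LaurentPolynomial.T ((i * q : ℕ) : ℤ)) /
    algebraMap ℂ[T;T⁻¹] (FractionRing ℂ[T;T⁻¹])
      (1 - LaurentPolynomial.C (u + u⁻¹) * LaurentPolynomial.T (p : ℤ) +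
        LaurentPolynomial.T ((2 * p : ℕ) : ℤ))

end

/-! ### Matrices of size two -/

section FinTwo

open Matrix

/-! Write X, Y for the images of x, y under an irreducible representation. The element x^p = y^q is
central, so by Schur's lemma X^p = Y^q is a scalar c, and c = ±1 because determinants are 1
(`IrrepSL2.exists_matX_pow`). Neither X nor Y is scalar, as they would then share an eigenvector. A
nonscalar matrix with a scalar power has distinct eigenvalues in characteristic zero, so those of X
are e^{±√-1 π a / p} with c = (-1)^a, and similarly for Y and b; hence a ≡ b mod 2
(`Matrix.exists_rootExp_trace`, `exists_hasEigenPair`). The traces determine the pair because the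
cosine is injective on [0, π].

The free derivatives of the relator are geometric sums, so multiplying det Φ(∂r/∂x) by det Φ(x - 1),
or det Φ(∂r/∂y) by det Φ(y - 1), gives (c t^{pq} - 1)² in both cases. The numerator of the formula
satisfies the same identity with det Φ(x - 1), and cancellation gives both quotients
(`wadaQuotient_torus`).

The pair of traces is continuous on the space of classes and takes finitely many values, so it is
locally constant and separates different pairs. Conversely, for a fixed pair one diagonalizes X and
rescales the eigenbasis until Y has first row (z, 1) (`Matrix.exists_normalForm`). Every z except μ
and μ⁻¹ gives an irreducible representation, so the classes with this pair form a continuous image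
of the connected set ℂ ∖ {μ, μ⁻¹}. The twisted Alexander polynomial depends only on the traces,
hence is locally constant. -/

theorem Matrix.sq_fin_two {R : Type*} [CommRing R] (M : Matrix (Fin 2) (Fin 2) R) :
    M * M = M.trace • M - M.det • (1 : Matrix (Fin 2) (Fin 2) R) := by
  ext i j
  fin_cases i <;> fin_cases j <;>
    simp [Matrix.mul_apply, Fin.sum_univ_two, Matrix.trace_fin_two, Matrix.det_fin_two] <;> ring

theorem Matrix.det_smul_sub_one_fin_two {R : Type*} [CommRing R]
    (M : Matrix (Fin 2) (Fin 2) R) (s : R) :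
    (s • M - 1).det = 1 - M.trace * s + M.det * s ^ 2 := by
  simp [Matrix.trace_fin_two, Matrix.det_fin_two]
  ring

theorem Matrix.hasEigenvalue_toLin'_iff_fin_two {K : Type*} [Field K]
    (M : Matrix (Fin 2) (Fin 2) K) (h : M.det = 1) (l : K) :
    Module.End.HasEigenvalue (Matrix.toLin' M) l ↔ l ≠ 0 ∧ M.trace = l + l⁻¹ := by
  rw [Module.End.hasEigenvalue_iff_isRoot_charpoly, Matrix.charpoly_toLin',
    Matrix.charpoly_fin_two, h]
  simp only [map_one, Polynomial.IsRoot.def, Polynomial.eval_add, Polynomial.eval_sub,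
    Polynomial.eval_pow, Polynomial.eval_X, Polynomial.eval_mul, Polynomial.eval_C,
    Polynomial.eval_one]
  constructor
  · intro hl
    have h0 : l ≠ 0 := by rintro rfl; simp at hl
    refine ⟨h0, ?_⟩
    field_simp
    linear_combination -hl
  · rintro ⟨h0, ht⟩
    rw [ht]
    field_simp
    ring

/-- The powers of a matrix with eigenvalues `l` and `l⁻¹`. -/
theorem Matrix.sub_smul_pow_fin_two {K : Type*} [Field K] (M : Matrix (Fin 2) (Fin 2) K)
    (h : M.det = 1) {l : K} (hl : l ≠ 0) (ht : M.trace = l + l⁻¹) (n : ℕ) :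
    (l - l⁻¹) • M ^ n = l ^ n • (M - l⁻¹ • (1 : Matrix (Fin 2) (Fin 2) K)) -
      l⁻¹ ^ n • (M - l • (1 : Matrix (Fin 2) (Fin 2) K)) := by
  induction n with
  | zero => simp only [pow_zero, one_smul, sub_smul]; abel
  | succ n ih =>
    have hl' : l * l⁻¹ = 1 := mul_inv_cancel₀ hl
    rw [pow_succ, ← smul_mul_assoc, ih, sub_mul, smul_mul_assoc, smul_mul_assoc, sub_mul, sub_mul,
      Matrix.sq_fin_two, h, ht, smul_mul_assoc, smul_mul_assoc, one_mul]
    generalize l⁻¹ = m at *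
    ext i j
    simp only [sub_apply, smul_apply, smul_eq_mul]
    generalize (1 : Matrix (Fin 2) (Fin 2) K) i j = e
    linear_combination (l ^ n * e - m ^ n * e) * hl'

/-- With distinct eigenvalues M is diagonalizable, and both eigenvalues have n-th power e. This
supplies the relation x^p = y^q when representations are constructed. -/
theorem Matrix.pow_fin_two_eq_smul_one {K : Type*} [Field K] (M : Matrix (Fin 2) (Fin 2) K)
    (h : M.det = 1) {l e : K} (hl : l ≠ 0) (hl' : l ≠ l⁻¹) (ht : M.trace = l + l⁻¹) {n : ℕ}
    (he : l ^ n = e) (he' : l⁻¹ ^ n = e) : M ^ n = e • (1 : Matrix (Fin 2) (Fin 2) K) := by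
  have h1 := Matrix.sub_smul_pow_fin_two M h hl ht n
  have h2 : l - l⁻¹ ≠ 0 := sub_ne_zero.mpr hl'
  apply smul_right_injective _ h2
  dsimp only
  rw [h1, he, he', ← smul_sub, smul_smul, mul_comm (l - l⁻¹), ← smul_smul, sub_sub_sub_cancel_left,
    sub_smul]

/-- The powers of a matrix with a double eigenvalue. -/
theorem Matrix.pow_succ_fin_two_of_sq_eq_one {K : Type*} [Field K] (M : Matrix (Fin 2) (Fin 2) K)
    (h : M.det = 1) {l : K} (hl : l * l = 1) (ht : M.trace = l + l) (n : ℕ) :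
    M ^ (n + 1) = l ^ (n + 1) • (1 : Matrix (Fin 2) (Fin 2) K) +
      ((n + 1 : ℕ) * l ^ n) • (M - l • (1 : Matrix (Fin 2) (Fin 2) K)) := by
  induction n with
  | zero => simp
  | succ n ih =>
    rw [pow_succ, ih, add_mul, smul_mul_assoc, smul_mul_assoc, sub_mul, Matrix.sq_fin_two, h, ht,
      smul_mul_assoc, one_mul]
    ext i j
    simp only [sub_apply, smul_apply, smul_eq_mul, add_apply]
    generalize (1 : Matrix (Fin 2) (Fin 2) K) i j = e
    push_cast
    linear_combination ((n + 1) * l ^ n * e) * hl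

/-- A matrix of determinant one over a field of characteristic zero, a power of which is scalar,
is scalar or has distinct eigenvalues. -/
theorem Matrix.eigenvalue_ne_inv_fin_two {K : Type*} [Field K] [CharZero K]
    (M : Matrix (Fin 2) (Fin 2) K) (h : M.det = 1) {l e : K} (hl : l ≠ 0) (ht : M.trace = l + l⁻¹)
    {n : ℕ} (hn : 0 < n) (hM : M ^ n = e • (1 : Matrix (Fin 2) (Fin 2) K)) (he : l ^ n = e)
    (hs : ∀ c : K, M ≠ c • (1 : Matrix (Fin 2) (Fin 2) K)) : l ≠ l⁻¹ := by
  intro hll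
  obtain ⟨n, rfl⟩ := Nat.exists_eq_succ_of_ne_zero hn.ne'
  have hl1 : l * l = 1 := by nth_rw 2 [hll]; exact mul_inv_cancel₀ hl
  have h1 := Matrix.pow_succ_fin_two_of_sq_eq_one M h hl1 (by rw [ht, ← hll]) n
  rw [Nat.succ_eq_add_one] at *
  -- The part of the power along M - l has coefficient (n + 1) lⁿ, nonzero in characteristic zero,
  -- so M itself would be scalar.
  rw [hM, he, left_eq_add, smul_eq_zero] at h1
  rcases h1 with h1 | h1
  · exact mul_ne_zero (Nat.cast_ne_zero.mpr n.succ_ne_zero) (pow_ne_zero n hl) h1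
  · exact hs l (sub_eq_zero.mp h1)

/-- The determinant of a geometric sum of a matrix, some power of which is scalar. -/
theorem Matrix.det_geom_sum_mul {R : Type*} [CommRing R] (M : Matrix (Fin 2) (Fin 2) R) (e : R)
    {n : ℕ} (hM : M ^ n = e • (1 : Matrix (Fin 2) (Fin 2) R)) :
    (∑ i ∈ Finset.range n, M ^ i).det * (M - 1).det = (e - 1) ^ 2 := by
  rw [← Matrix.det_mul, geom_sum_mul, hM]
  simp [Matrix.det_fin_two]
  ring

end FinTwo

/-! ### The numbers `e^{√-1 π a / n}` -/

theorem rootExp_ne_zero (a n : ℕ) : rootExp a n ≠ 0 := Complex.exp_ne_zero _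

theorem rootExp_pow {a n : ℕ} (hn : 0 < n) : rootExp a n ^ n = (-1) ^ a := by
  have h : (n : ℂ) ≠ 0 := Nat.cast_ne_zero.mpr hn.ne'
  rw [rootExp, ← Complex.exp_nat_mul, ← Complex.exp_pi_mul_I, ← Complex.exp_nat_mul]
  congr 1
  field_simp

theorem rootExp_inv_pow {a n : ℕ} (hn : 0 < n) : (rootExp a n)⁻¹ ^ n = (-1) ^ a := by
  rw [inv_pow, rootExp_pow hn, ← inv_pow, inv_neg_one]

theorem rootExp_add_inv (a n : ℕ) :
    rootExp a n + (rootExp a n)⁻¹ = ((2 * Real.cos (Real.pi * a / n) : ℝ) : ℂ) := by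
  rw [rootExp, ← Complex.exp_neg]
  push_cast
  rw [Complex.cos]
  ring_nf

/-- The sum is 2 cos(πa/n), and the cosine is injective on [0, π]. -/
theorem rootExp_add_inv_injective {a b n : ℕ} (ha : a < n) (hb : b < n)
    (h : rootExp a n + (rootExp a n)⁻¹ = rootExp b n + (rootExp b n)⁻¹) : a = b := by
  have hn : (0 : ℝ) < n := by exact_mod_cast (Nat.zero_le a).trans_lt ha
  have hm : ∀ {c : ℕ}, c < n → Real.pi * c / n ∈ Set.Icc 0 Real.pi := fun {c} hc => by
    refine ⟨by positivity, ?_⟩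
    rw [div_le_iff₀ hn]
    exact mul_le_mul_of_nonneg_left (by exact_mod_cast hc.le) Real.pi_pos.le
  rw [rootExp_add_inv, rootExp_add_inv, Complex.ofReal_inj] at h
  have h1 := Real.injOn_cos (hm ha) (hm hb) (mul_left_cancel₀ two_ne_zero h)
  have h2 := Real.pi_ne_zero
  field_simp at h1
  exact_mod_cast h1

theorem rootExp_ne_inv {a n : ℕ} (ha : 0 < a) (han : a < n) : rootExp a n ≠ (rootExp a n)⁻¹ := by
  have hn : (0 : ℝ) < n := by exact_mod_cast ha.trans han
  intro h
  have h1 : rootExp a n * rootExp a n = 1 := by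
    nth_rw 2 [h]; exact mul_inv_cancel₀ (rootExp_ne_zero a n)
  rw [rootExp, ← Complex.exp_add, Complex.exp_eq_one_iff] at h1
  obtain ⟨k, hk⟩ := h1
  have h2 : (a : ℂ) = k * n := by
    have h3 := Complex.I_ne_zero
    have h4 : (Real.pi : ℂ) ≠ 0 := by exact_mod_cast Real.pi_ne_zero
    have h5 : (n : ℂ) ≠ 0 := by exact_mod_cast hn.ne'
    field_simp at hk
    linear_combination hk / 2
  have h3 : (a : ℤ) = k * n := by exact_mod_cast h2
  have h4 : n ∣ a := by
    rw [← Int.natCast_dvd_natCast]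
    exact ⟨k, by rw [h3, mul_comm]⟩
  exact absurd (Nat.le_of_dvd ha h4) han.not_ge

/-- A root of unity of order dividing `2 n`, other than `±1`, is `e^{± √-1 π a / n}` for some
`0 < a < n`. -/
theorem exists_rootExp {n : ℕ} (hn : 0 < n) {l : ℂ} (h : l ^ (2 * n) = 1) (hl : l ≠ l⁻¹) :
    ∃ a, 0 < a ∧ a < n ∧ (l = rootExp a n ∨ l⁻¹ = rootExp a n) := by
  have h0 : (n : ℂ) ≠ 0 := by exact_mod_cast hn.ne'
  have : NeZero (2 * n) := ⟨by omega⟩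
  obtain ⟨i, hi, rfl⟩ := (Complex.isPrimitiveRoot_exp (2 * n) (by omega)).eq_pow_of_pow_eq_one h
  have key : Complex.exp (2 * Real.pi * Complex.I / (2 * n : ℕ)) ^ i = rootExp i n := by
    rw [rootExp, ← Complex.exp_nat_mul]
    congr 1
    push_cast
    field_simp
  rw [key] at hl ⊢
  have hi0 : i ≠ 0 := by rintro rfl; simp [rootExp] at hl
  have hin : i ≠ n := by
    rintro rfl
    apply hl
    rw [rootExp, mul_div_assoc, div_self h0, mul_one, mul_comm, Complex.exp_pi_mul_I, inv_neg_one]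
  rcases lt_or_gt_of_ne hin with h1 | h1
  · exact ⟨i, Nat.pos_of_ne_zero hi0, h1, Or.inl rfl⟩
  -- An exponent between n and 2n lies in the lower half plane; inversion reflects it to 2n - i.
  · refine ⟨2 * n - i, by omega, by omega, Or.inr ?_⟩
    rw [rootExp, rootExp, ← Complex.exp_neg, Complex.exp_eq_exp_iff_exists_int]
    refine ⟨-1, ?_⟩
    rw [Nat.cast_sub hi.le]
    push_cast
    field_simp
    ring

/-! ### Free differentials of the relator of the torus knot group -/

theorem foxDeriv_one {ι : Type} [DecidableEq ι] (j : ι) :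
    foxDeriv j (MonoidAlgebra.of ℤ (FreeGroup ι) 1) = 0 := by
  rw [foxDeriv_of]; simp [foxWord]

theorem foxDeriv_inv {ι : Type} [DecidableEq ι] (j : ι) (g : FreeGroup ι) :
    foxDeriv j (MonoidAlgebra.of ℤ _ g⁻¹) =
      -(MonoidAlgebra.of ℤ _ g⁻¹ * foxDeriv j (MonoidAlgebra.of ℤ _ g)) := by
  have h := foxDeriv_mul j g⁻¹ g
  rw [inv_mul_cancel, foxDeriv_one] at h
  exact eq_neg_of_add_eq_zero_left h.symm

theorem foxDeriv_pow {ι : Type} [DecidableEq ι] (j : ι) (g : FreeGroup ι) (n : ℕ) :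
    foxDeriv j (MonoidAlgebra.of ℤ _ (g ^ n)) =
      (∑ i ∈ Finset.range n, MonoidAlgebra.of ℤ _ g ^ i) *
        foxDeriv j (MonoidAlgebra.of ℤ _ g) := by
  induction n with
  | zero => rw [pow_zero, foxDeriv_one]; simp
  | succ n ih => rw [pow_succ, foxDeriv_mul, ih, Finset.sum_range_succ, add_mul, map_pow]

theorem foxDeriv_zero_torusRel (p q : ℕ) :
    foxDeriv 0 (MonoidAlgebra.of ℤ _ (torusRel p q 0)) =
      ∑ i ∈ Finset.range p, MonoidAlgebra.of ℤ _ (FreeGroup.of 0) ^ i := by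
  rw [torusRel, foxDeriv_mul, foxDeriv_inv, foxDeriv_pow, foxDeriv_pow, foxDeriv_generator,
    foxDeriv_generator]
  simp

/-- The relator is kept as a left factor because Φ sends it to 1. -/
theorem foxDeriv_one_torusRel (p q : ℕ) :
    foxDeriv 1 (MonoidAlgebra.of ℤ _ (torusRel p q 0)) =
      -(MonoidAlgebra.of ℤ _ (torusRel p q 0) *
        ∑ i ∈ Finset.range q, MonoidAlgebra.of ℤ _ (FreeGroup.of 1) ^ i) := by
  rw [torusRel, foxDeriv_mul, foxDeriv_inv, foxDeriv_pow, foxDeriv_pow, foxDeriv_generator,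
    foxDeriv_generator, map_mul, if_neg zero_ne_one, if_pos rfl, mul_zero, zero_add, mul_one,
    mul_neg, mul_assoc]

/-! ### Values of Φ on words, and the factorization of det Φ(xₖ - 1). -/

section Wada

variable {K : Type} [Field K] {m : ℕ} {r : Fin m → FreeGroup (Fin (m + 1))}

theorem wadaMap_of (α : PresentedGroup (Set.range r) →* Multiplicative ℤ)
    (ρ : PresentedGroup (Set.range r) →* Matrix.SpecialLinearGroup (Fin 2) K)
    (g : FreeGroup (Fin (m + 1))) :
    wadaMap α ρ (MonoidAlgebra.of ℤ _ g) =
      (LaurentPolynomial.T (α (PresentedGroup.mk _ g)).toAdd : K[T;T⁻¹]) •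
          ((ρ (PresentedGroup.mk _ g) : Matrix (Fin 2) (Fin 2) K).map LaurentPolynomial.C) := by
  rw [wadaMap, MonoidAlgebra.lift_of]
  rfl

theorem wadaMap_relator (α : PresentedGroup (Set.range r) →* Multiplicative ℤ)
    (ρ : PresentedGroup (Set.range r) →* Matrix.SpecialLinearGroup (Fin 2) K) (i : Fin m) :
    wadaMap α ρ (MonoidAlgebra.of ℤ _ (r i)) = 1 := by
  rw [wadaMap_of, PresentedGroup.one_of_mem (rels := Set.range r) (Set.mem_range_self i)]
  simp

/-- `Φ(xₖ)`. -/
theorem wadaMap_generator (α : PresentedGroup (Set.range r) →* Multiplicative ℤ)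
    (ρ : PresentedGroup (Set.range r) →* Matrix.SpecialLinearGroup (Fin 2) K) (k : Fin (m + 1)) :
    wadaMap α ρ (MonoidAlgebra.of ℤ _ (FreeGroup.of k)) =
      (LaurentPolynomial.T (α (PresentedGroup.of k)).toAdd : K[T;T⁻¹]) •
          ((ρ (PresentedGroup.of k) : Matrix (Fin 2) (Fin 2) K).map LaurentPolynomial.C) :=
  wadaMap_of α ρ _

theorem wadaDenominator_eq (α : PresentedGroup (Set.range r) →* Multiplicative ℤ)
    (ρ : PresentedGroup (Set.range r) →* Matrix.SpecialLinearGroup (Fin 2) K) (k : Fin (m + 1)) :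
    wadaDenominator α ρ k =
      1 - LaurentPolynomial.C (ρ (PresentedGroup.of k) : Matrix (Fin 2) (Fin 2) K).trace *
          LaurentPolynomial.T (α (PresentedGroup.of k)).toAdd +
        LaurentPolynomial.T (α (PresentedGroup.of k)).toAdd ^ 2 := by
  rw [wadaDenominator, map_sub, map_one, wadaMap_generator, Matrix.det_smul_sub_one_fin_two,
    ← RingHom.mapMatrix_apply, ← RingHom.map_det, Matrix.SpecialLinearGroup.det_coe,
    RingHom.mapMatrix_apply, ← AddMonoidHom.map_trace]
  simp

/-- `det Φ(xₖ - 1) = (l tⁿ - 1) (l⁻¹ tⁿ - 1)` if `l` is an eigenvalue of `ρ(xₖ)`. -/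
theorem wadaDenominator_eq_mul (α : PresentedGroup (Set.range r) →* Multiplicative ℤ)
    (ρ : PresentedGroup (Set.range r) →* Matrix.SpecialLinearGroup (Fin 2) K) (k : Fin (m + 1))
    {l : K} (hl : l ≠ 0)
    (ht : (ρ (PresentedGroup.of k) : Matrix (Fin 2) (Fin 2) K).trace = l + l⁻¹) :
    wadaDenominator α ρ k =
      (LaurentPolynomial.C l * LaurentPolynomial.T (α (PresentedGroup.of k)).toAdd - 1) *
      (LaurentPolynomial.C l⁻¹ * LaurentPolynomial.T (α (PresentedGroup.of k)).toAdd - 1) := by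
  have h : (LaurentPolynomial.C l : K[T;T⁻¹]) * LaurentPolynomial.C l⁻¹ = 1 := by
    rw [← map_mul, mul_inv_cancel₀ hl, map_one]
  rw [wadaDenominator_eq, ht, map_add]
  linear_combination -(LaurentPolynomial.T (α (PresentedGroup.of k)).toAdd ^ 2 : K[T;T⁻¹]) * h

/-- For l ≠ 0 the degrees n and 0 of the two terms differ. This makes the denominators nonzero. -/
theorem LaurentPolynomial.C_mul_T_sub_one_ne_zero (l : K) {n : ℤ} (hn : n ≠ 0) :
    (LaurentPolynomial.C l * LaurentPolynomial.T n - 1 : K[T;T⁻¹]) ≠ 0 := by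
  intro h
  rcases eq_or_ne l 0 with rfl | hl
  · simp at h
  · have h1 := congrArg LaurentPolynomial.degree (sub_eq_zero.mp h)
    rw [LaurentPolynomial.degree_C_mul_T _ _ hl, ← map_one LaurentPolynomial.C,
      LaurentPolynomial.degree_C one_ne_zero] at h1
    exact hn (WithBot.coe_injective h1)

end Wada

/-- Applied to Φ(x) with exponent p and to Φ(y) with exponent q, this gives the same scalar e
t^{pq}. -/
theorem Matrix.smul_map_C_pow {K : Type*} [Field K] {M : Matrix (Fin 2) (Fin 2) K} {n : ℕ} {e : K}
    (h : M ^ n = e • (1 : Matrix (Fin 2) (Fin 2) K)) (a : ℕ) :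
    ((LaurentPolynomial.T (a : ℤ) : K[T;T⁻¹]) • M.map LaurentPolynomial.C) ^ n =
      (LaurentPolynomial.C e * LaurentPolynomial.T ((n * a : ℕ) : ℤ) : K[T;T⁻¹]) •
        (1 : Matrix (Fin 2) (Fin 2) K[T;T⁻¹]) := by
  have h1 : (e • (1 : Matrix (Fin 2) (Fin 2) K)).map LaurentPolynomial.C =
      (LaurentPolynomial.C e : K[T;T⁻¹]) • (1 : Matrix (Fin 2) (Fin 2) K[T;T⁻¹]) := by
    ext1 i j
    simp only [Matrix.map_apply, Matrix.smul_apply, smul_eq_mul, map_mul, Matrix.one_apply,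
      apply_ite LaurentPolynomial.C, map_one, map_zero]
  rw [smul_pow, ← RingHom.mapMatrix_apply, ← map_pow, h, LaurentPolynomial.T_pow,
    RingHom.mapMatrix_apply, h1, smul_smul, mul_comm, Nat.cast_mul]

/-! ### Determinant identities for the torus knot group. -/

section Torus

variable {p q : ℕ} (ρ : TorusKnotGroup p q →* Matrix.SpecialLinearGroup (Fin 2) ℂ)

theorem wadaMap_torus_zero :
    wadaMap (torusAb p q) ρ (MonoidAlgebra.of ℤ _ (FreeGroup.of 0)) =
      (LaurentPolynomial.T (q : ℤ) : ℂ[T;T⁻¹]) •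
        (ρ (torusX p q) : Matrix (Fin 2) (Fin 2) ℂ).map LaurentPolynomial.C := by
  rw [wadaMap_generator, ← torusX, torusAb_torusX, toAdd_ofAdd]

theorem wadaMap_torus_one :
    wadaMap (torusAb p q) ρ (MonoidAlgebra.of ℤ _ (FreeGroup.of 1)) =
      (LaurentPolynomial.T (p : ℤ) : ℂ[T;T⁻¹]) •
        (ρ (torusY p q) : Matrix (Fin 2) (Fin 2) ℂ).map LaurentPolynomial.C := by
  rw [wadaMap_generator, ← torusY, torusAb_torusY, toAdd_ofAdd]

/-- Removing the column of x leaves the single block of ∂/∂y, so the index 0 goes with the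
derivative in the other generator. -/
theorem det_twistedAlexanderMatrix_zero :
    (twistedAlexanderMatrix (torusAb p q) ρ 0).det =
      (wadaMap (torusAb p q) ρ (foxDeriv 1 (MonoidAlgebra.of ℤ _ (torusRel p q 0)))).det := by
  rw [← Matrix.det_submatrix_equiv_self (Equiv.uniqueProd (Fin 2) (Fin 1)).symm]
  rfl

theorem det_twistedAlexanderMatrix_one :
    (twistedAlexanderMatrix (torusAb p q) ρ 1).det =
      (wadaMap (torusAb p q) ρ (foxDeriv 0 (MonoidAlgebra.of ℤ _ (torusRel p q 0)))).det := by
  rw [← Matrix.det_submatrix_equiv_self (Equiv.uniqueProd (Fin 2) (Fin 1)).symm]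
  rfl

/-- If `yᵠ` acts as a scalar `e`, then `det Φ(∂r/∂y) det Φ(y - 1) = (e t^{pq} - 1)²`. -/
theorem det_twistedAlexanderMatrix_zero_mul {e : ℂ}
    (hY : (ρ (torusY p q) : Matrix (Fin 2) (Fin 2) ℂ) ^ q = e • (1 : Matrix (Fin 2) (Fin 2) ℂ)) :
    (twistedAlexanderMatrix (torusAb p q) ρ 0).det * wadaDenominator (torusAb p q) ρ 1 =
      (LaurentPolynomial.C e * LaurentPolynomial.T ((p * q : ℕ) : ℤ) - 1) ^ 2 := by
  rw [det_twistedAlexanderMatrix_zero, wadaDenominator, map_sub, map_one, foxDeriv_one_torusRel,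
    map_neg, map_mul, wadaMap_relator, one_mul, map_sum, Matrix.det_neg]
  simp only [map_pow]
  rw [wadaMap_torus_one, Fintype.card_fin, neg_one_sq, one_mul,
    Matrix.det_geom_sum_mul _ _ (Matrix.smul_map_C_pow hY p), mul_comm q p]

/-- If `xᵖ` acts as a scalar `e`, then `det Φ(∂r/∂x) det Φ(x - 1) = (e t^{pq} - 1)²`. -/
theorem det_twistedAlexanderMatrix_one_mul {e : ℂ}
    (hX : (ρ (torusX p q) : Matrix (Fin 2) (Fin 2) ℂ) ^ p = e • (1 : Matrix (Fin 2) (Fin 2) ℂ)) :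
    (twistedAlexanderMatrix (torusAb p q) ρ 1).det * wadaDenominator (torusAb p q) ρ 0 =
      (LaurentPolynomial.C e * LaurentPolynomial.T ((p * q : ℕ) : ℤ) - 1) ^ 2 := by
  rw [det_twistedAlexanderMatrix_one, wadaDenominator, map_sub, map_one, foxDeriv_zero_torusRel,
    map_sum]
  simp only [map_pow]
  rw [wadaMap_torus_zero, Matrix.det_geom_sum_mul _ _ (Matrix.smul_map_C_pow hX q)]

theorem wadaDenominator_torus_zero {l : ℂ} (hl : l ≠ 0)
    (hx : (ρ (torusX p q) : Matrix (Fin 2) (Fin 2) ℂ).trace = l + l⁻¹) :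
    wadaDenominator (torusAb p q) ρ 0 =
      (LaurentPolynomial.C l * LaurentPolynomial.T (q : ℤ) - 1) *
      (LaurentPolynomial.C l⁻¹ * LaurentPolynomial.T (q : ℤ) - 1) := by
  rw [wadaDenominator_eq_mul _ _ 0 hl hx, ← torusX, torusAb_torusX, toAdd_ofAdd]

theorem wadaDenominator_torus_one {u : ℂ} (hu : u ≠ 0)
    (hy : (ρ (torusY p q) : Matrix (Fin 2) (Fin 2) ℂ).trace = u + u⁻¹) :
    wadaDenominator (torusAb p q) ρ 1 =
      (LaurentPolynomial.C u * LaurentPolynomial.T (p : ℤ) - 1) *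
      (LaurentPolynomial.C u⁻¹ * LaurentPolynomial.T (p : ℤ) - 1) := by
  rw [wadaDenominator_eq_mul _ _ 1 hu hy, ← torusY, torusAb_torusY, toAdd_ofAdd]

end Torus

theorem geom_sum_C_mul_T (l : ℂ) (n : ℕ) {p : ℕ} {e : ℂ} (h : l ^ p = e) :
    (∑ i ∈ Finset.range p, LaurentPolynomial.C (l ^ i) * LaurentPolynomial.T ((i * n : ℕ) : ℤ)) *
      (LaurentPolynomial.C l * LaurentPolynomial.T (n : ℤ) - 1) =
    (LaurentPolynomial.C e * LaurentPolynomial.T ((p * n : ℕ) : ℤ) - 1 : ℂ[T;T⁻¹]) := by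
  have key : ∀ i : ℕ,
      (LaurentPolynomial.C (l ^ i) * LaurentPolynomial.T ((i * n : ℕ) : ℤ) : ℂ[T;T⁻¹]) =
        (LaurentPolynomial.C l * LaurentPolynomial.T (n : ℤ)) ^ i := by
    intro i
    rw [mul_pow, map_pow, LaurentPolynomial.T_pow, Nat.cast_mul]
  simp only [key]
  rw [geom_sum_mul, ← key, h]

theorem torusDenominator_eq_mul (p : ℕ) {u : ℂ} (hu : u ≠ 0) :
    (1 - LaurentPolynomial.C (u + u⁻¹) * LaurentPolynomial.T (p : ℤ) +
        LaurentPolynomial.T ((2 * p : ℕ) : ℤ) : ℂ[T;T⁻¹]) =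
      (LaurentPolynomial.C u * LaurentPolynomial.T (p : ℤ) - 1) *
      (LaurentPolynomial.C u⁻¹ * LaurentPolynomial.T (p : ℤ) - 1) := by
  have h : (LaurentPolynomial.C u : ℂ[T;T⁻¹]) * LaurentPolynomial.C u⁻¹ = 1 := by
    rw [← map_mul, mul_inv_cancel₀ hu, map_one]
  rw [map_add, Nat.cast_mul, ← LaurentPolynomial.T_pow]
  linear_combination (-LaurentPolynomial.T (p : ℤ) ^ 2 : ℂ[T;T⁻¹]) * h

theorem FractionRing.algebraMap_div_eq_div {R : Type*} [CommRing R] [IsDomain R] {a b c d : R}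
    (hb : b ≠ 0) (hd : d ≠ 0) (h : a * d = c * b) :
    algebraMap R (FractionRing R) a / algebraMap R (FractionRing R) b =
      algebraMap R (FractionRing R) c / algebraMap R (FractionRing R) d := by
  have hinj := IsFractionRing.injective R (FractionRing R)
  rw [div_eq_div_iff ((map_ne_zero_iff _ hinj).mpr hb) ((map_ne_zero_iff _ hinj).mpr hd),
    ← map_mul, ← map_mul, h]

/-! ### The two Wada quotients. -/

section Torus

variable {p q : ℕ} (hp : 0 < p) (hq : 0 < q)
  (ρ : TorusKnotGroup p q →* Matrix.SpecialLinearGroup (Fin 2) ℂ) {l u e : ℂ} (hl : l ≠ 0)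
  (hu : u ≠ 0)
  (hx : (ρ (torusX p q) : Matrix (Fin 2) (Fin 2) ℂ).trace = l + l⁻¹)
  (hy : (ρ (torusY p q) : Matrix (Fin 2) (Fin 2) ℂ).trace = u + u⁻¹)

include hq hl hx in
theorem wadaDenominator_torus_zero_ne_zero : wadaDenominator (torusAb p q) ρ 0 ≠ 0 := by
  have hq' : (q : ℤ) ≠ 0 := by exact_mod_cast hq.ne'
  rw [wadaDenominator_torus_zero ρ hl hx]
  exact mul_ne_zero (LaurentPolynomial.C_mul_T_sub_one_ne_zero _ hq')
    (LaurentPolynomial.C_mul_T_sub_one_ne_zero _ hq')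

include hp hu hy in
theorem wadaDenominator_torus_one_ne_zero : wadaDenominator (torusAb p q) ρ 1 ≠ 0 := by
  have hp' : (p : ℤ) ≠ 0 := by exact_mod_cast hp.ne'
  rw [wadaDenominator_torus_one ρ hu hy]
  exact mul_ne_zero (LaurentPolynomial.C_mul_T_sub_one_ne_zero _ hp')
    (LaurentPolynomial.C_mul_T_sub_one_ne_zero _ hp')

include hl hx in
theorem torusNumerator_mul (he : l ^ p = e) (he' : l⁻¹ ^ p = e) :
    ((∑ i ∈ Finset.range p,
        LaurentPolynomial.C (l ^ i) * LaurentPolynomial.T ((i * q : ℕ) : ℤ)) *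
        ∑ i ∈ Finset.range p,
          LaurentPolynomial.C (l⁻¹ ^ i) * LaurentPolynomial.T ((i * q : ℕ) : ℤ)) *
      wadaDenominator (torusAb p q) ρ 0 =
      (LaurentPolynomial.C e * LaurentPolynomial.T ((p * q : ℕ) : ℤ) - 1 : ℂ[T;T⁻¹]) ^ 2 := by
  rw [wadaDenominator_torus_zero ρ hl hx, mul_mul_mul_comm, geom_sum_C_mul_T l q he,
    geom_sum_C_mul_T l⁻¹ q he', sq]

include hp hq hl hu hx hy

/-- The denominator of the formula is det Φ(y - 1), so the two fractions are compared by
cross-multiplication: both products equal (e t^{pq} - 1)². -/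
theorem wadaQuotient_torus_zero
    (hY : (ρ (torusY p q) : Matrix (Fin 2) (Fin 2) ℂ) ^ q = e • (1 : Matrix (Fin 2) (Fin 2) ℂ))
    (he : l ^ p = e) (he' : l⁻¹ ^ p = e) :
    wadaQuotient (torusAb p q) ρ 0 = torusFormula p q l u := by
  rw [torusFormula, torusDenominator_eq_mul p hu, ← wadaDenominator_torus_one ρ hu hy]
  exact FractionRing.algebraMap_div_eq_div (wadaDenominator_torus_zero_ne_zero hq ρ hl hx)
    (wadaDenominator_torus_one_ne_zero hp ρ hu hy)
    ((det_twistedAlexanderMatrix_zero_mul ρ hY).trans (torusNumerator_mul ρ hl hx he he').symm)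

omit hp in
-- Here the denominators coincide. The numerators agree after multiplication by det Φ(x - 1), which
-- is nonzero and cancels.
theorem wadaQuotient_torus_one
    (hX : (ρ (torusX p q) : Matrix (Fin 2) (Fin 2) ℂ) ^ p = e • (1 : Matrix (Fin 2) (Fin 2) ℂ))
    (he : l ^ p = e) (he' : l⁻¹ ^ p = e) :
    wadaQuotient (torusAb p q) ρ 1 = torusFormula p q l u := by
  rw [torusFormula, torusDenominator_eq_mul p hu, ← wadaDenominator_torus_one ρ hu hy,
    ← mul_right_cancel₀ (wadaDenominator_torus_zero_ne_zero hq ρ hl hx)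
      ((det_twistedAlexanderMatrix_one_mul ρ hX).trans (torusNumerator_mul ρ hl hx he he').symm)]
  rfl

/-- The twisted Alexander polynomial of the torus knot, computed by removing any column. -/
theorem wadaQuotient_torus
    (hX : (ρ (torusX p q) : Matrix (Fin 2) (Fin 2) ℂ) ^ p = e • (1 : Matrix (Fin 2) (Fin 2) ℂ))
    (hY : (ρ (torusY p q) : Matrix (Fin 2) (Fin 2) ℂ) ^ q = e • (1 : Matrix (Fin 2) (Fin 2) ℂ))
    (he : l ^ p = e) (he' : l⁻¹ ^ p = e) : ∀ k : Fin 2,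
    wadaDenominator (torusAb p q) ρ k ≠ 0 ∧
      wadaQuotient (torusAb p q) ρ k = torusFormula p q l u :=
  Fin.forall_fin_two.mpr
    ⟨⟨wadaDenominator_torus_zero_ne_zero hq ρ hl hx,
      wadaQuotient_torus_zero hp hq ρ hl hu hx hy hY he he'⟩,
    ⟨wadaDenominator_torus_one_ne_zero hp ρ hu hy,
      wadaQuotient_torus_one hq ρ hl hu hx hy hX he he'⟩⟩

end Torus

/-- The column chosen in the definition is arbitrary, so the value is known once all columns give
the same quotient. -/
theorem twistedAlexander_eq_of_forall {K : Type} [Field K] {m : ℕ}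
    {r : Fin m → FreeGroup (Fin (m + 1))} (α : PresentedGroup (Set.range r) →* Multiplicative ℤ)
    (ρ : PresentedGroup (Set.range r) →* Matrix.SpecialLinearGroup (Fin 2) K)
    {f : FractionRing K[T;T⁻¹]} (h : ∀ k, wadaDenominator α ρ k ≠ 0 ∧ wadaQuotient α ρ k = f) :
    twistedAlexander α ρ = f := by
  rw [twistedAlexander, dif_pos ⟨0, (h 0).1⟩]
  exact (h _).2

/-! ### Irreducible representations of the torus knot group -/

theorem standardRep_apply {G : Type} [Group G] (ρ : G →* Matrix.SpecialLinearGroup (Fin 2) ℂ)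
    (g : G) (v : Fin 2 → ℂ) :
    standardRep ρ g v = (ρ g : Matrix (Fin 2) (Fin 2) ℂ).mulVec v := rfl

/-- By Cayley–Hamilton A⁻¹ = tr(A) - A, so a subspace stable under A is stable under A⁻¹. -/
theorem Matrix.SpecialLinearGroup.inv_mulVec_fin_two {K : Type*} [Field K]
    (A : Matrix.SpecialLinearGroup (Fin 2) K) (v : Fin 2 → K) :
    ((A⁻¹ : Matrix.SpecialLinearGroup (Fin 2) K) : Matrix (Fin 2) (Fin 2) K).mulVec v =
      (A : Matrix (Fin 2) (Fin 2) K).trace • v - (A : Matrix (Fin 2) (Fin 2) K).mulVec v := by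
  rw [Matrix.SpecialLinearGroup.coe_inv, Matrix.adjugate_fin_two]
  ext i
  fin_cases i <;> simp [Matrix.mulVec, dotProduct, Fin.sum_univ_two, Matrix.trace_fin_two] <;> ring

theorem TorusKnotGroup.induction {p q : ℕ} {P : TorusKnotGroup p q → Prop} (hx : P (torusX p q))
    (hy : P (torusY p q)) (h1 : P 1) (hmul : ∀ g h, P g → P h → P (g * h))
    (hinv : ∀ g, P g → P g⁻¹) (g : TorusKnotGroup p q) : P g := by
  have hg : g ∈ Subgroup.closure
      (Set.range (PresentedGroup.of : Fin 2 → TorusKnotGroup p q)) := by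
    rw [PresentedGroup.closure_range_of]; trivial
  induction hg using Subgroup.closure_induction with
  | mem g hg =>
    obtain ⟨i, rfl⟩ := hg
    revert i
    exact Fin.forall_fin_two.mpr ⟨hx, hy⟩
  | one => exact h1
  | mul g h _ _ hg hh => exact hmul g h hg hh
  | inv g _ hg => exact hinv g hg

theorem TorusKnotGroup.hom_ext {p q : ℕ} {H : Type*} [Group H] {f g : TorusKnotGroup p q →* H}
    (hx : f (torusX p q) = g (torusX p q)) (hy : f (torusY p q) = g (torusY p q)) : f = g :=
  PresentedGroup.ext (Fin.forall_fin_two.mpr ⟨hx, hy⟩)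

theorem mulVec_mem_of_generators {p q : ℕ}
    (ρ : TorusKnotGroup p q →* Matrix.SpecialLinearGroup (Fin 2) ℂ) (W : Submodule ℂ (Fin 2 → ℂ))
    (hx : ∀ v ∈ W, (ρ (torusX p q) : Matrix (Fin 2) (Fin 2) ℂ).mulVec v ∈ W)
    (hy : ∀ v ∈ W, (ρ (torusY p q) : Matrix (Fin 2) (Fin 2) ℂ).mulVec v ∈ W)
    (g : TorusKnotGroup p q) : ∀ v ∈ W, (ρ g : Matrix (Fin 2) (Fin 2) ℂ).mulVec v ∈ W := by
  induction g using TorusKnotGroup.induction with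
  | hx => exact hx
  | hy => exact hy
  | h1 => simp
  | hmul g h hg hh =>
    intro v hv
    rw [map_mul, Matrix.SpecialLinearGroup.coe_mul, ← Matrix.mulVec_mulVec]
    exact hg _ (hh _ hv)
  | hinv g hg =>
    intro v hv
    rw [map_inv, Matrix.SpecialLinearGroup.inv_mulVec_fin_two]
    exact W.sub_mem (W.smul_mem _ hv) (hg v hv)

section Irreducible

variable {p q : ℕ} (ρ : IrrepSL2 (TorusKnotGroup p q))

/-- The matrix of `x`. -/
abbrev IrrepSL2.matX : Matrix (Fin 2) (Fin 2) ℂ := (ρ.1 (torusX p q)).1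

/-- The matrix of `y`. -/
abbrev IrrepSL2.matY : Matrix (Fin 2) (Fin 2) ℂ := (ρ.1 (torusY p q)).1

theorem IrrepSL2.eq_top_of_invariant (W : Submodule ℂ (Fin 2 → ℂ))
    (hx : ∀ v ∈ W, ρ.matX.mulVec v ∈ W) (hy : ∀ v ∈ W, ρ.matY.mulVec v ∈ W)
    {v : Fin 2 → ℂ} (hv : v ∈ W) (hv0 : v ≠ 0) : W = ⊤ := by
  have := ρ.2
  rcases eq_bot_or_eq_top (⟨W, mulVec_mem_of_generators ρ.1 W hx hy⟩ :
    Subrepresentation (standardRep ρ.1)) with h | h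
  · have h1 : W = ⊥ := congrArg Subrepresentation.toSubmodule h
    rw [h1] at hv
    exact absurd hv hv0
  · exact congrArg Subrepresentation.toSubmodule h

theorem IrrepSL2.no_common_eigenvector {v : Fin 2 → ℂ} (hv : v ≠ 0) {c d : ℂ}
    (hx : ρ.matX.mulVec v = c • v) (hy : ρ.matY.mulVec v = d • v) : False := by
  have h := ρ.eq_top_of_invariant (ℂ ∙ v)
    (fun w hw => by
      obtain ⟨a, rfl⟩ := Submodule.mem_span_singleton.mp hw
      rw [Matrix.mulVec_smul, hx]
      exact Submodule.smul_mem _ _ (Submodule.smul_mem _ _ (Submodule.mem_span_singleton_self v)))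
    (fun w hw => by
      obtain ⟨a, rfl⟩ := Submodule.mem_span_singleton.mp hw
      rw [Matrix.mulVec_smul, hy]
      exact Submodule.smul_mem _ _ (Submodule.smul_mem _ _ (Submodule.mem_span_singleton_self v)))
    (Submodule.mem_span_singleton_self v) hv
  have h1 := finrank_span_singleton (K := ℂ) hv
  rw [h, finrank_top] at h1
  simp at h1

theorem Matrix.exists_mulVec_eq_smul (M : Matrix (Fin 2) (Fin 2) ℂ) :
    ∃ (c : ℂ) (v : Fin 2 → ℂ), v ≠ 0 ∧ M.mulVec v = c • v := by
  obtain ⟨c, hc⟩ := Module.End.exists_eigenvalue (Matrix.toLin' M)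
  obtain ⟨v, hv⟩ := hc.exists_hasEigenvector
  exact ⟨c, v, hv.2, hv.apply_eq_smul⟩

/-- If X were scalar, any eigenvector of Y would be a common eigenvector. -/
theorem IrrepSL2.matX_ne_smul_one (c : ℂ) : ρ.matX ≠ c • 1 := by
  intro h
  obtain ⟨d, v, hv, hd⟩ := ρ.matY.exists_mulVec_eq_smul
  exact ρ.no_common_eigenvector hv (c := c) (by rw [h, Matrix.smul_mulVec, Matrix.one_mulVec]) hd

theorem IrrepSL2.matY_ne_smul_one (c : ℂ) : ρ.matY ≠ c • 1 := by
  intro h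
  obtain ⟨d, v, hv, hd⟩ := ρ.matX.exists_mulVec_eq_smul
  exact ρ.no_common_eigenvector hv hd (d := c) (by rw [h, Matrix.smul_mulVec, Matrix.one_mulVec])

theorem IrrepSL2.matX_pow : ρ.matX ^ p = ρ.matY ^ q := by
  have h := congrArg ρ.1 (torusX_pow p q)
  rw [map_pow, map_pow] at h
  exact congrArg Subtype.val h

/-- Schur's lemma. -/
theorem IrrepSL2.eq_smul_one_of_commute {Z : Matrix (Fin 2) (Fin 2) ℂ} (hx : Commute ρ.matX Z)
    (hy : Commute ρ.matY Z) : ∃ c : ℂ, Z = c • (1 : Matrix (Fin 2) (Fin 2) ℂ) := by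
  obtain ⟨c, v, hv, hc⟩ := Z.exists_mulVec_eq_smul
  have key : ∀ M, Commute M Z → ∀ v ∈ LinearMap.ker (Matrix.toLin' (Z - c • 1)),
      M.mulVec v ∈ LinearMap.ker (Matrix.toLin' (Z - c • 1)) := by
    intro M hM v hv
    rw [LinearMap.mem_ker, Matrix.toLin'_apply, Matrix.sub_mulVec, Matrix.smul_mulVec,
      Matrix.one_mulVec, sub_eq_zero] at hv ⊢
    rw [Matrix.mulVec_mulVec, ← hM.eq, ← Matrix.mulVec_mulVec, hv, Matrix.mulVec_smul]
  -- The eigenspace ker(Z - c) is invariant and contains v ≠ 0, so it is the whole plane.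
  have h := ρ.eq_top_of_invariant _ (key _ hx) (key _ hy) (v := v) (by
    rw [LinearMap.mem_ker, Matrix.toLin'_apply, Matrix.sub_mulVec, Matrix.smul_mulVec,
      Matrix.one_mulVec, hc, sub_self]) hv
  rw [LinearMap.ker_eq_top, LinearEquiv.map_eq_zero_iff] at h
  exact ⟨c, sub_eq_zero.mp h⟩

/-- X^p commutes with X, and with Y because it equals Y^q; Schur's lemma makes it a scalar c, and
taking determinants gives c² = 1. -/
theorem IrrepSL2.exists_matX_pow : ∃ c : ℂ, c ^ 2 = 1 ∧ ρ.matX ^ p = c • 1 ∧ ρ.matY ^ q = c • 1 := by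
  obtain ⟨c, hc⟩ := ρ.eq_smul_one_of_commute (Z := ρ.matX ^ p) (Commute.self_pow _ _) (by
    rw [ρ.matX_pow]; exact Commute.self_pow _ _)
  refine ⟨c, ?_, hc, by rw [← ρ.matX_pow, hc]⟩
  have h := congrArg Matrix.det hc
  rw [Matrix.det_pow, Matrix.SpecialLinearGroup.det_coe, one_pow, Matrix.det_smul, Matrix.det_one,
    Fintype.card_fin, mul_one] at h
  exact h.symm

end Irreducible

/-- An eigenvalue l satisfies lⁿ = c, hence l^{2n} = 1, and l ≠ l⁻¹ as M is not scalar. Passing to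
l⁻¹ if necessary changes neither the trace nor c = ±1. -/
theorem Matrix.exists_rootExp_trace {M : Matrix (Fin 2) (Fin 2) ℂ} (hM : M.det = 1)
    (hs : ∀ c : ℂ, M ≠ c • (1 : Matrix (Fin 2) (Fin 2) ℂ)) {n : ℕ} (hn : 0 < n) {c : ℂ}
    (hc : c ^ 2 = 1) (hMn : M ^ n = c • (1 : Matrix (Fin 2) (Fin 2) ℂ)) :
    ∃ a, 0 < a ∧ a < n ∧ M.trace = rootExp a n + (rootExp a n)⁻¹ ∧ c = (-1) ^ a := by
  obtain ⟨l, hl⟩ := Module.End.exists_eigenvalue (Matrix.toLin' M)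
  obtain ⟨v, hv⟩ := hl.exists_hasEigenvector
  obtain ⟨hl0, ht⟩ := (Matrix.hasEigenvalue_toLin'_iff_fin_two M hM l).mp hl
  have hln : l ^ n = c := by
    have h1 := hv.pow_apply n
    rw [← Matrix.toLin'_pow, hMn, Matrix.toLin'_apply, Matrix.smul_mulVec, Matrix.one_mulVec] at h1
    exact (smul_left_injective ℂ hv.2 h1).symm
  have hll := Matrix.eigenvalue_ne_inv_fin_two M hM hl0 ht hn hMn hln hs
  obtain ⟨a, ha, han, h⟩ := exists_rootExp hn (by rw [mul_comm, pow_mul, hln, hc]) hll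
  refine ⟨a, ha, han, ?_, ?_⟩
  · rcases h with h | h
    · rw [ht, h]
    · rw [ht, ← h, inv_inv, add_comm]
  · rcases h with h | h
    · rw [← hln, h, rootExp_pow hn]
    · rw [← hln, ← inv_inv l, h, rootExp_inv_pow hn]

/-! ### The pair (a, b) of an irreducible representation. -/

section Pair

variable {p q : ℕ} (ρ : IrrepSL2 (TorusKnotGroup p q))

/-- In determinant 1 an eigenvalue condition is a trace condition, and traces are conjugation
invariant and continuous. -/
theorem hasEigenPair_iff (a b : ℕ) : HasEigenPair ρ a b ↔ 0 < a ∧ a < p ∧ 0 < b ∧ b < q ∧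
    ρ.matX.trace = rootExp a p + (rootExp a p)⁻¹ ∧
    ρ.matY.trace = rootExp b q + (rootExp b q)⁻¹ := by
  have h1 := Matrix.hasEigenvalue_toLin'_iff_fin_two ρ.matX
    (Matrix.SpecialLinearGroup.det_coe _) (rootExp a p)
  have h2 := Matrix.hasEigenvalue_toLin'_iff_fin_two ρ.matY
    (Matrix.SpecialLinearGroup.det_coe _) (rootExp b q)
  rw [and_iff_right (rootExp_ne_zero _ _)] at h1 h2
  rw [← h1, ← h2]
  rfl

variable {ρ}

theorem HasEigenPair.eq_of_trace_eq {σ : IrrepSL2 (TorusKnotGroup p q)} {a b c d : ℕ}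
    (h : HasEigenPair ρ a b) (k : HasEigenPair σ c d) (hx : ρ.matX.trace = σ.matX.trace)
    (hy : ρ.matY.trace = σ.matY.trace) : a = c ∧ b = d := by
  rw [hasEigenPair_iff] at h k
  obtain ⟨-, ha, -, hb, h1, h2⟩ := h
  obtain ⟨-, hc, -, hd, k1, k2⟩ := k
  exact ⟨rootExp_add_inv_injective ha hc (by rw [← h1, hx, k1]),
    rootExp_add_inv_injective hb hd (by rw [← h2, hy, k2])⟩

variable (ρ) in
theorem exists_hasEigenPair (hp : 0 < p) (hq : 0 < q) : ∃ a b, HasEigenPair ρ a b ∧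
    ρ.matX ^ p = ((-1) ^ a : ℂ) • (1 : Matrix (Fin 2) (Fin 2) ℂ) ∧
    ρ.matY ^ q = ((-1) ^ a : ℂ) • (1 : Matrix (Fin 2) (Fin 2) ℂ) ∧
    a ≡ b [MOD 2] := by
  obtain ⟨c, hc, hX, hY⟩ := ρ.exists_matX_pow
  obtain ⟨a, ha, hap, hta, hca⟩ := Matrix.exists_rootExp_trace
    (Matrix.SpecialLinearGroup.det_coe _) ρ.matX_ne_smul_one hp hc hX
  obtain ⟨b, hb, hbq, htb, hcb⟩ := Matrix.exists_rootExp_trace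
    (Matrix.SpecialLinearGroup.det_coe _) ρ.matY_ne_smul_one hq hc hY
  refine ⟨a, b, (hasEigenPair_iff ρ a b).mpr ⟨ha, hap, hb, hbq, hta, htb⟩, ?_, ?_, ?_⟩
  · rw [← hca, hX]
  · rw [← hca, hY]
  -- The parities agree because X^p and Y^q are the same scalar c.
  · have h : ((-1) ^ a : ℂ) = (-1) ^ b := hca.symm.trans hcb
    have h2 : Even a ↔ Even b := by
      rw [← neg_one_pow_eq_one_iff_even (R := ℂ) (by norm_num), h,
        neg_one_pow_eq_one_iff_even (by norm_num)]
    rw [Nat.ModEq]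
    rw [Nat.even_iff, Nat.even_iff] at h2
    omega

variable (ρ) in
theorem existsUnique_hasEigenPair (hp : 0 < p) (hq : 0 < q) :
    ∃! ab : ℕ × ℕ, HasEigenPair ρ ab.1 ab.2 := by
  obtain ⟨a, b, h, -⟩ := exists_hasEigenPair ρ hp hq
  refine ⟨(a, b), h, fun cd k => ?_⟩
  obtain ⟨h1, h2⟩ := HasEigenPair.eq_of_trace_eq k h rfl rfl
  exact Prod.ext h1 h2

theorem HasEigenPair.modEq_and_pow {a b : ℕ} (hp : 0 < p) (hq : 0 < q) (h : HasEigenPair ρ a b) :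
    a ≡ b [MOD 2] ∧ ρ.matX ^ p = ((-1) ^ a : ℂ) • (1 : Matrix (Fin 2) (Fin 2) ℂ) ∧
    ρ.matY ^ q = ((-1) ^ a : ℂ) • (1 : Matrix (Fin 2) (Fin 2) ℂ) := by
  obtain ⟨c, d, k, hX, hY, hcd⟩ := exists_hasEigenPair ρ hp hq
  obtain ⟨rfl, rfl⟩ := HasEigenPair.eq_of_trace_eq h k rfl rfl
  exact ⟨hcd, hX, hY⟩

theorem HasEigenPair.wadaQuotient_eq {a b : ℕ} (hp : 0 < p) (hq : 0 < q)
    (h : HasEigenPair ρ a b) : ∀ k : Fin 2, wadaDenominator (torusAb p q) ρ.1 k ≠ 0 ∧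
      wadaQuotient (torusAb p q) ρ.1 k = torusFormula p q (rootExp a p) (rootExp b q) := by
  obtain ⟨-, hX, hY⟩ := h.modEq_and_pow hp hq
  obtain ⟨-, -, -, -, hx, hy⟩ := (hasEigenPair_iff ρ a b).mp h
  exact wadaQuotient_torus hp hq ρ.1 (rootExp_ne_zero a p) (rootExp_ne_zero b q) hx hy hX hY
    (rootExp_pow hp) (rootExp_inv_pow hp)

theorem HasEigenPair.twistedAlexander_eq {a b : ℕ} (hp : 0 < p) (hq : 0 < q)
    (h : HasEigenPair ρ a b) :
    twistedAlexander (torusAb p q) ρ.1 = torusFormula p q (rootExp a p) (rootExp b q) :=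
  twistedAlexander_eq_of_forall _ _ (h.wadaQuotient_eq hp hq)

theorem twistedAlexander_eq_of_trace_eq (hp : 0 < p) (hq : 0 < q)
    {σ : IrrepSL2 (TorusKnotGroup p q)} (hx : ρ.matX.trace = σ.matX.trace)
    (hy : ρ.matY.trace = σ.matY.trace) :
    twistedAlexander (torusAb p q) ρ.1 = twistedAlexander (torusAb p q) σ.1 := by
  obtain ⟨a, b, h, -⟩ := exists_hasEigenPair ρ hp hq
  obtain ⟨c, d, k, -⟩ := exists_hasEigenPair σ hp hq
  obtain ⟨rfl, rfl⟩ := h.eq_of_trace_eq k hx hy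
  rw [h.twistedAlexander_eq hp hq, k.twistedAlexander_eq hp hq]

end Pair

/-! ### The traces as functions on the space of conjugacy classes -/

section Trace

variable {p q : ℕ}

/-- The pair of traces `(tr ρ(x), tr ρ(y))`. -/
def classTrace : IrrepClass (TorusKnotGroup p q) → ℂ × ℂ :=
  Quotient.lift (fun ρ : IrrepSL2 (TorusKnotGroup p q) => (ρ.matX.trace, ρ.matY.trace)) <| by
    rintro ρ σ ⟨P, hP⟩
    have key : ∀ g, (ρ.1 g : Matrix (Fin 2) (Fin 2) ℂ).trace =
        (σ.1 g : Matrix (Fin 2) (Fin 2) ℂ).trace := by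
      intro g
      rw [hP g, Matrix.SpecialLinearGroup.coe_mul, Matrix.trace_mul_comm,
        ← Matrix.SpecialLinearGroup.coe_mul, inv_mul_cancel_left]
    exact Prod.ext (key _) (key _)

theorem continuous_irrep_apply {G : Type} [Group G] (g : G) :
    Continuous fun ρ : IrrepSL2 G => (ρ.1 g : Matrix (Fin 2) (Fin 2) ℂ) :=
  (continuous_apply g).comp
    (continuous_induced_dom (f := fun (ρ : IrrepSL2 G) (g : G) => (ρ.1 g).1))

theorem continuous_classTrace : Continuous (classTrace (p := p) (q := q)) :=
  Continuous.quotient_lift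
    ((continuous_irrep_apply _).matrix_trace.prodMk (continuous_irrep_apply _).matrix_trace) _

theorem finite_range_classTrace (hp : 0 < p) (hq : 0 < q) :
    (Set.range (classTrace (p := p) (q := q))).Finite := by
  refine (((Set.finite_Iio p).prod (Set.finite_Iio q)).image fun ab : ℕ × ℕ =>
    (rootExp ab.1 p + (rootExp ab.1 p)⁻¹, rootExp ab.2 q + (rootExp ab.2 q)⁻¹)).subset ?_
  rintro _ ⟨c, rfl⟩
  induction c using Quotient.inductionOn with
  | h ρ =>
    obtain ⟨a, b, h, -⟩ := exists_hasEigenPair ρ hp hq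
    obtain ⟨-, ha, -, hb, hx, hy⟩ := (hasEigenPair_iff ρ a b).mp h
    exact ⟨(a, b), ⟨ha, hb⟩, Prod.ext hx.symm hy.symm⟩

theorem Continuous.isLocallyConstant_of_finite_range {X Y : Type*} [TopologicalSpace X]
    [TopologicalSpace Y] [T1Space Y] {f : X → Y} (hf : Continuous f) (h : (Set.range f).Finite) :
    IsLocallyConstant f := by
  rw [IsLocallyConstant.iff_isOpen_fiber]
  intro y
  -- The remaining values form a finite, hence closed, set, so each fibre is open.
  have h1 : f ⁻¹' {y} = f ⁻¹' (Set.range f \ {y})ᶜ := by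
    ext x
    simp
  rw [h1]
  exact (h.subset Set.sdiff_subset).isClosed.isOpen_compl.preimage hf

theorem isLocallyConstant_classTrace (hp : 0 < p) (hq : 0 < q) :
    IsLocallyConstant (classTrace (p := p) (q := q)) :=
  continuous_classTrace.isLocallyConstant_of_finite_range (finite_range_classTrace hp hq)

/-- The twisted Alexander polynomial as a function on the space of conjugacy classes. -/
noncomputable def classTwistedAlexander (hp : 0 < p) (hq : 0 < q) :
    IrrepClass (TorusKnotGroup p q) → FractionRing ℂ[T;T⁻¹] :=
  Quotient.lift (fun ρ : IrrepSL2 (TorusKnotGroup p q) => twistedAlexander (torusAb p q) ρ.1)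
    fun ρ σ h => by
      have h1 : classTrace ⟦ρ⟧ = classTrace ⟦σ⟧ := congrArg classTrace (Quotient.sound h)
      exact twistedAlexander_eq_of_trace_eq hp hq (congrArg Prod.fst h1) (congrArg Prod.snd h1)

theorem isLocallyConstant_classTwistedAlexander (hp : 0 < p) (hq : 0 < q) :
    IsLocallyConstant (classTwistedAlexander (p := p) (q := q) hp hq) := by
  rw [IsLocallyConstant.iff_eventually_eq]
  intro c
  filter_upwards [(isLocallyConstant_classTrace hp hq).eventually_eq c] with d hd
  induction c using Quotient.inductionOn with
  | h ρ =>
    induction d using Quotient.inductionOn with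
    | h σ =>
      exact twistedAlexander_eq_of_trace_eq hp hq (congrArg Prod.fst hd) (congrArg Prod.snd hd)

end Trace

/-! ### Normal forms of irreducible representations -/

section NormalForm

open Matrix

theorem Matrix.exists_mulVec_eq_of_trace {M : Matrix (Fin 2) (Fin 2) ℂ} (hM : M.det = 1) {l : ℂ}
    (hl : l ≠ 0) (ht : M.trace = l + l⁻¹) : ∃ v : Fin 2 → ℂ, v ≠ 0 ∧ M.mulVec v = l • v := by
  obtain ⟨v, hv⟩ := ((Matrix.hasEigenvalue_toLin'_iff_fin_two M hM l).mpr
    ⟨hl, ht⟩).exists_hasEigenvector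
  exact ⟨v, hv.2, hv.apply_eq_smul⟩

/-- Diagonalization of a matrix of size two with eigenvalues `l ≠ l⁻¹`. -/
theorem Matrix.exists_diagonalization_fin_two {M : Matrix (Fin 2) (Fin 2) ℂ} (hM : M.det = 1)
    {l : ℂ} (hl : l ≠ 0) (hll : l ≠ l⁻¹) (ht : M.trace = l + l⁻¹) :
    ∃ P : Matrix (Fin 2) (Fin 2) ℂ, P.det ≠ 0 ∧ M * P = P * !![l, 0; 0, l⁻¹] := by
  obtain ⟨v, hv, hMv⟩ := exists_mulVec_eq_of_trace hM hl ht
  obtain ⟨w, hw, hMw⟩ := exists_mulVec_eq_of_trace hM (inv_ne_zero hl)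
    (by rw [ht, inv_inv, add_comm])
  have v0 := congrFun hMv 0
  have v1 := congrFun hMv 1
  have w0 := congrFun hMw 0
  have w1 := congrFun hMw 1
  simp only [mulVec, dotProduct, Fin.sum_univ_two, Pi.smul_apply, smul_eq_mul] at v0 v1 w0 w1
  have hll' := sub_ne_zero.mpr hll
  refine ⟨!![v 0, w 0; v 1, w 1], ?_, ?_⟩
  · rw [det_fin_two_of]
    -- If v and w were proportional, the eigenvalue equations would give (l - l⁻¹) vᵢ wᵢ = 0 at a
    -- coordinate with wᵢ ≠ 0, forcing v = 0.
    intro hd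
    generalize l⁻¹ = m at *
    rcases eq_or_ne (w 0) 0 with h0 | h0
    · have h1 : w 1 ≠ 0 := fun h1 => hw (by ext i; fin_cases i <;> assumption)
      have h2 : v 0 = 0 := by
        rw [h0, zero_mul, sub_zero] at hd
        exact (mul_eq_zero.mp hd).resolve_right h1
      have h3 : (l - m) * (v 1 * w 1) = 0 := by
        rw [h0] at w1
        rw [h2] at v1
        linear_combination v 1 * w1 - w 1 * v1
      rcases mul_eq_zero.mp ((mul_eq_zero.mp h3).resolve_left hll') with h4 | h4
      · exact hv (by ext i; fin_cases i <;> assumption)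
      · exact h1 h4
    · have h3 : (l - m) * (v 0 * w 0) = 0 := by
        linear_combination v 0 * w0 - w 0 * v0 - M 0 1 * hd
      have h4 := (mul_eq_zero.mp ((mul_eq_zero.mp h3).resolve_left hll')).resolve_right h0
      have h5 : v 1 = 0 := by
        rw [h4, zero_mul, zero_sub, neg_eq_zero] at hd
        exact (mul_eq_zero.mp hd).resolve_left h0
      exact hv (by ext i; fin_cases i <;> assumption)
  · ext i j
    fin_cases i <;> fin_cases j <;> simp [Matrix.mul_apply, Fin.sum_univ_two]
    · linear_combination v0
    · linear_combination w0
    · linear_combination v1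
    · linear_combination w1

/-- A pair of matrices without a common eigenvector, the first of which has eigenvalues
`l ≠ l⁻¹`, is conjugate to a pair in normal form. -/
theorem Matrix.exists_normalForm {M N : Matrix (Fin 2) (Fin 2) ℂ} (hM : M.det = 1) (hN : N.det = 1)
    {l t : ℂ} (hl : l ≠ 0) (hll : l ≠ l⁻¹) (htM : M.trace = l + l⁻¹) (htN : N.trace = t)
    (h : ∀ v : Fin 2 → ℂ, v ≠ 0 → ∀ c d : ℂ, M.mulVec v = c • v → N.mulVec v = d • v → False) :
    ∃ (P : SpecialLinearGroup (Fin 2) ℂ) (z : ℂ), z * (t - z) - 1 ≠ 0 ∧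
      M * P.1 = P.1 * !![l, 0; 0, l⁻¹] ∧ N * P.1 = P.1 * !![z, 1; z * (t - z) - 1, t - z] := by
  obtain ⟨P, hP, hMP⟩ := exists_diagonalization_fin_two hM hl hll htM
  have hPu : IsUnit P.det := isUnit_iff_ne_zero.mpr hP
  have hPi : P * P⁻¹ = 1 := mul_nonsing_inv P hPu
  -- L is N written in an eigenbasis of M. A vanishing off-diagonal entry of L would make a basis
  -- vector a common eigenvector.
  set L := P⁻¹ * N * P with hL
  have hNP : N * P = P * L := by rw [hL, ← mul_assoc, ← mul_assoc, hPi, one_mul]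
  have hdL : L.det = 1 := by
    have h1 := congrArg Matrix.det hNP
    rw [det_mul, det_mul, hN, one_mul] at h1
    exact (mul_eq_left₀ hP).mp h1.symm
  have htL : L.trace = t := by rw [hL, mul_assoc, trace_mul_comm, mul_assoc, hPi, mul_one, htN]
  clear_value L
  rw [det_fin_two] at hdL
  rw [trace_fin_two] at htL
  have hne : ∀ v : Fin 2 → ℂ, v ≠ 0 → P.mulVec v ≠ 0 := by
    intro v hv h0
    exact hP (exists_mulVec_eq_zero_iff.mp ⟨v, hv, h0⟩)
  have h01 : L 0 1 ≠ 0 := by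
    intro h0
    refine h (P.mulVec ![0, 1]) (hne _ (by simp)) l⁻¹ (L 1 1) ?_ ?_
    · rw [mulVec_mulVec, hMP, ← mulVec_mulVec, ← mulVec_smul]
      congr 1; ext i; fin_cases i <;> simp
    · rw [mulVec_mulVec, hNP, ← mulVec_mulVec, ← mulVec_smul]
      congr 1; ext i; fin_cases i <;> simp [h0, mulVec, dotProduct, Fin.sum_univ_two]
  have h10 : L 1 0 ≠ 0 := by
    intro h0
    refine h (P.mulVec ![1, 0]) (hne _ (by simp)) l (L 0 0) ?_ ?_
    · rw [mulVec_mulVec, hMP, ← mulVec_mulVec, ← mulVec_smul]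
      congr 1; ext i; fin_cases i <;> simp
    · rw [mulVec_mulVec, hNP, ← mulVec_mulVec, ← mulVec_smul]
      congr 1; ext i; fin_cases i <;> simp [h0, mulVec, dotProduct, Fin.sum_univ_two]
  have h11 : L 1 1 = t - L 0 0 := by linear_combination htL
  have hz : L 0 0 * (t - L 0 0) - 1 = L 1 0 * L 0 1 := by rw [← h11]; linear_combination hdL
  -- Conjugating by diag(L₀₁, 1) preserves diagonal matrices and turns the upper right entry of L
  -- into 1; the scalar s brings the determinant of the conjugating matrix to 1.
  obtain ⟨s, hs⟩ := IsAlgClosed.exists_pow_nat_eq ((P.det * L 0 1)⁻¹) two_pos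
  refine ⟨⟨s • (P * !![L 0 1, 0; 0, 1]), ?_⟩, L 0 0, ?_, ?_, ?_⟩
  · rw [det_smul, det_mul, det_fin_two_of, Fintype.card_fin, hs]
    field_simp
    ring
  · rw [hz]; exact mul_ne_zero h10 h01
  · change M * (s • (P * !![L 0 1, 0; 0, 1])) = (s • (P * !![L 0 1, 0; 0, 1])) * !![l, 0; 0, l⁻¹]
    rw [mul_smul_comm, smul_mul_assoc, ← mul_assoc, hMP, mul_assoc, mul_assoc]
    congr 2
    ext i j
    fin_cases i <;> fin_cases j <;> simp [mul_comm]
  · change N * (s • (P * !![L 0 1, 0; 0, 1])) = (s • (P * !![L 0 1, 0; 0, 1])) * _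
    rw [mul_smul_comm, smul_mul_assoc, ← mul_assoc, hNP, mul_assoc, mul_assoc, hz, ← h11]
    congr 2
    ext i j
    fin_cases i <;> fin_cases j <;> simp [Matrix.mul_apply, Fin.sum_univ_two, mul_comm]

end NormalForm

/-! ### The family of irreducible representations with a given pair of traces -/

/-- The diagonal matrix with entries `l` and `l⁻¹`. -/
noncomputable def normalX (l : ℂ) (hl : l ≠ 0) : Matrix.SpecialLinearGroup (Fin 2) ℂ :=
  ⟨!![l, 0; 0, l⁻¹], by rw [Matrix.det_fin_two_of, mul_inv_cancel₀ hl]; ring⟩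

/-- The matrix of trace `t` and determinant one with first row `(z, 1)`. -/
def normalY (t z : ℂ) : Matrix.SpecialLinearGroup (Fin 2) ℂ :=
  ⟨!![z, 1; z * (t - z) - 1, t - z], by rw [Matrix.det_fin_two_of]; ring⟩

theorem continuous_normalY (t : ℂ) : Continuous (normalY t) := by
  refine continuous_induced_rng.mpr (continuous_matrix fun i j => ?_)
  fin_cases i <;> fin_cases j <;> simp <;> fun_prop

section Family

variable {p q : ℕ}

/-- The representation of the torus knot group given by two matrices. -/
def torusHom {A B : Matrix.SpecialLinearGroup (Fin 2) ℂ} (h : A ^ p = B ^ q) :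
    TorusKnotGroup p q →* Matrix.SpecialLinearGroup (Fin 2) ℂ :=
  PresentedGroup.toGroup (f := ![A, B]) <| by
    rintro _ ⟨i, rfl⟩
    simp only [torusRel, map_mul, map_pow, map_inv, FreeGroup.lift_apply_of, Matrix.cons_val_zero,
      Matrix.cons_val_one]
    rw [h, mul_inv_cancel]

theorem torusHom_torusX {A B : Matrix.SpecialLinearGroup (Fin 2) ℂ} (h : A ^ p = B ^ q) :
    torusHom h (torusX p q) = A :=
  PresentedGroup.toGroup.of _

theorem torusHom_torusY {A B : Matrix.SpecialLinearGroup (Fin 2) ℂ} (h : A ^ p = B ^ q) :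
    torusHom h (torusY p q) = B :=
  PresentedGroup.toGroup.of _

/-- A nonzero invariant subspace contains a coordinate vector because X has distinct eigenvalues.
Both off-diagonal entries of Y are nonzero, so it then contains the other one. -/
theorem isIrreducible_of_normalForm (ρ : TorusKnotGroup p q →* Matrix.SpecialLinearGroup (Fin 2) ℂ)
    {l t z : ℂ} {hl : l ≠ 0} (hll : l ≠ l⁻¹) (hz : z * (t - z) - 1 ≠ 0)
    (hx : ρ (torusX p q) = normalX l hl) (hy : ρ (torusY p q) = normalY t z) :
    (standardRep ρ).IsIrreducible := by
  have key : ∀ W : Subrepresentation (standardRep ρ), W = ⊥ ∨ W = ⊤ := by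
    intro W
    have hX : ∀ v ∈ W.toSubmodule, ![l * v 0, l⁻¹ * v 1] ∈ W.toSubmodule := by
      intro v hv
      have h := W.apply_mem_toSubmodule (torusX p q) hv
      rw [standardRep_apply, hx] at h
      convert h using 1
      ext i
      fin_cases i <;> simp [normalX, Matrix.mulVec, dotProduct, Fin.sum_univ_two]
    have hY : ∀ v ∈ W.toSubmodule,
        ![z * v 0 + v 1, (z * (t - z) - 1) * v 0 + (t - z) * v 1] ∈ W.toSubmodule := by
      intro v hv
      have h := W.apply_mem_toSubmodule (torusY p q) hv
      rw [standardRep_apply, hy] at h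
      convert h using 1
      ext i
      fin_cases i <;> simp [normalY, Matrix.mulVec, dotProduct, Fin.sum_univ_two]
    have hll' := sub_ne_zero.mpr hll
    have top_of : ![1, 0] ∈ W.toSubmodule → ![0, 1] ∈ W.toSubmodule → W = ⊤ := by
      intro h1 h2
      apply Subrepresentation.toSubmodule_injective
      refine eq_top_iff.mpr fun v _ => ?_
      have h3 := W.toSubmodule.add_mem (W.toSubmodule.smul_mem (v 0) h1)
        (W.toSubmodule.smul_mem (v 1) h2)
      convert h3 using 1
      ext i
      fin_cases i <;> simp
    by_cases hW : W.toSubmodule = ⊥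
    · exact Or.inl (Subrepresentation.toSubmodule_injective hW)
    right
    obtain ⟨v, hv, hv0⟩ := (Submodule.ne_bot_iff _).mp hW
    rcases eq_or_ne (v 0) 0 with h0 | h0
    · have h1 : v 1 ≠ 0 := fun h1 => hv0 (by ext i; fin_cases i <;> assumption)
      have e2 : ![0, 1] ∈ W.toSubmodule := by
        convert W.toSubmodule.smul_mem (v 1)⁻¹ hv using 1
        ext i
        fin_cases i <;> simp [h0, h1]
      refine top_of ?_ e2
      convert W.toSubmodule.sub_mem (hY _ e2) (W.toSubmodule.smul_mem (t - z) e2) using 1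
      ext i
      fin_cases i <;> simp
    -- X - l⁻¹ kills the second coordinate and multiplies the first by l - l⁻¹.
    · have e1 : ![1, 0] ∈ W.toSubmodule := by
        convert W.toSubmodule.smul_mem ((l - l⁻¹) * v 0)⁻¹
          (W.toSubmodule.sub_mem (hX _ hv) (W.toSubmodule.smul_mem l⁻¹ hv)) using 1
        ext i
        fin_cases i
        · simp only [Fin.zero_eta, Matrix.cons_val_zero, Pi.smul_apply, Pi.sub_apply, smul_eq_mul]
          rw [← sub_mul, inv_mul_cancel₀ (mul_ne_zero hll' h0)]
        · change (0 : ℂ) = _ * (l⁻¹ * v 1 - l⁻¹ * v 1)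
          rw [sub_self, mul_zero]
      refine top_of e1 ?_
      convert W.toSubmodule.smul_mem (z * (t - z) - 1)⁻¹
        (W.toSubmodule.sub_mem (hY _ e1) (W.toSubmodule.smul_mem z e1)) using 1
      ext i
      fin_cases i <;> simp [hz]
  exact
    { exists_pair_ne := ⟨⊥, ⊤, fun h =>
        bot_ne_top (α := Submodule ℂ (Fin 2 → ℂ)) (congrArg Subrepresentation.toSubmodule h)⟩
      eq_bot_or_eq_top := key }

variable {a b : ℕ} (ha : 0 < a) (hap : a < p) (hb : 0 < b) (hbq : b < q) (hab : a ≡ b [MOD 2])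

include ha hap hb hbq hab in
-- The eigenvalues do not depend on z, so both powers are the scalar (-1)^a = (-1)^b along the whole
-- family.
theorem normalX_pow_eq_normalY_pow (z : ℂ) :
    normalX (rootExp a p) (rootExp_ne_zero a p) ^ p =
      normalY (rootExp b q + (rootExp b q)⁻¹) z ^ q := by
  have h : ((-1) ^ a : ℂ) = (-1) ^ b := by
    rw [neg_one_pow_eq_pow_mod_two, hab, ← neg_one_pow_eq_pow_mod_two]
  apply Subtype.ext
  rw [Matrix.SpecialLinearGroup.coe_pow, Matrix.SpecialLinearGroup.coe_pow,
    Matrix.pow_fin_two_eq_smul_one _ (Matrix.SpecialLinearGroup.det_coe _) (rootExp_ne_zero a p)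
      (rootExp_ne_inv ha hap) ?_ (rootExp_pow (ha.trans hap)) (rootExp_inv_pow (ha.trans hap)),
    Matrix.pow_fin_two_eq_smul_one _ (Matrix.SpecialLinearGroup.det_coe _) (rootExp_ne_zero b q)
      (rootExp_ne_inv hb hbq) ?_ (rootExp_pow (hb.trans hbq)) (rootExp_inv_pow (hb.trans hbq)), h]
  · simp [normalY, Matrix.trace_fin_two]
  · simp [normalX, Matrix.trace_fin_two]

/-- The irreducible representations with the pair `(a, b)`, up to conjugation. -/
noncomputable def torusFamily
    (z : {z : ℂ // z * (rootExp b q + (rootExp b q)⁻¹ - z) - 1 ≠ 0}) :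
    IrrepSL2 (TorusKnotGroup p q) :=
  ⟨torusHom (normalX_pow_eq_normalY_pow ha hap hb hbq hab z.1),
    isIrreducible_of_normalForm _ (rootExp_ne_inv ha hap) z.2 (torusHom_torusX _)
      (torusHom_torusY _)⟩

theorem torusFamily_torusX (z : {z : ℂ // z * (rootExp b q + (rootExp b q)⁻¹ - z) - 1 ≠ 0}) :
    (torusFamily ha hap hb hbq hab z).1 (torusX p q) =
      normalX (rootExp a p) (rootExp_ne_zero a p) :=
  torusHom_torusX (normalX_pow_eq_normalY_pow ha hap hb hbq hab z.1)

theorem torusFamily_torusY (z : {z : ℂ // z * (rootExp b q + (rootExp b q)⁻¹ - z) - 1 ≠ 0}) :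
    (torusFamily ha hap hb hbq hab z).1 (torusY p q) =
      normalY (rootExp b q + (rootExp b q)⁻¹) z.1 :=
  torusHom_torusY (normalX_pow_eq_normalY_pow ha hap hb hbq hab z.1)

theorem hasEigenPair_torusFamily
    (z : {z : ℂ // z * (rootExp b q + (rootExp b q)⁻¹ - z) - 1 ≠ 0}) :
    HasEigenPair (torusFamily ha hap hb hbq hab z) a b := by
  refine (hasEigenPair_iff _ a b).mpr ⟨ha, hap, hb, hbq, ?_, ?_⟩
  · rw [IrrepSL2.matX, torusFamily_torusX]
    simp [normalX, Matrix.trace_fin_two]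
  · rw [IrrepSL2.matY, torusFamily_torusY]
    simp [normalY, Matrix.trace_fin_two]

/-- The elements g whose image varies continuously with z are closed under products and inverses,
and include both generators. -/
theorem continuous_torusFamily : Continuous (torusFamily ha hap hb hbq hab) := by
  refine continuous_induced_rng.mpr (continuous_pi fun g => ?_)
  have key : Continuous fun z : {z : ℂ // z * (rootExp b q + (rootExp b q)⁻¹ - z) - 1 ≠ 0} =>
      (torusFamily ha hap hb hbq hab z).1 g := by
    induction g using TorusKnotGroup.induction with
    | hx =>
      simp only [torusFamily_torusX]
      exact continuous_const
    | hy =>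
      simp only [torusFamily_torusY]
      exact (continuous_normalY _).comp continuous_subtype_val
    | h1 =>
      simp only [map_one]
      exact continuous_const
    | hmul g h hg hh =>
      simp only [map_mul]
      exact hg.mul hh
    | hinv g hg =>
      simp only [map_inv]
      exact hg.inv
  exact continuous_subtype_val.comp key

/-- The lower left entry of the normal form factors as -(z - u)(z - u⁻¹), so reducibility excludes
just two points. -/
theorem compl_pair_eq (u : ℂ) (hu : u ≠ 0) :
    {z : ℂ | z * (u + u⁻¹ - z) - 1 ≠ 0} = ({u, u⁻¹} : Set ℂ)ᶜ := by
  ext z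
  have h : z * (u + u⁻¹ - z) - 1 = -((z - u) * (z - u⁻¹)) := by
    linear_combination mul_inv_cancel₀ hu
  rw [Set.mem_ofPred_eq, h]
  simp [sub_eq_zero]

/-- The complement of a countable set in a real vector space of dimension at least 2 is connected.
-/
theorem isConnected_normalForm (u : ℂ) (hu : u ≠ 0) :
    IsConnected {z : ℂ | z * (u + u⁻¹ - z) - 1 ≠ 0} := by
  rw [compl_pair_eq u hu]
  exact (Set.toFinite _).countable.isConnected_compl_of_one_lt_rank (by simp)

theorem exists_hasEigenPair_of_modEq (ha : 0 < a) (hap : a < p) (hb : 0 < b) (hbq : b < q)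
    (hab : a ≡ b [MOD 2]) : ∃ ρ : IrrepSL2 (TorusKnotGroup p q), HasEigenPair ρ a b := by
  obtain ⟨z, hz⟩ := (isConnected_normalForm (rootExp b q) (rootExp_ne_zero b q)).nonempty
  exact ⟨_, hasEigenPair_torusFamily ha hap hb hbq hab ⟨z, hz⟩⟩

theorem HasEigenPair.exists_torusFamily_equiv {ρ : IrrepSL2 (TorusKnotGroup p q)}
    (h : HasEigenPair ρ a b) : ∃ z, ρ ≈ torusFamily ha hap hb hbq hab z := by
  obtain ⟨-, -, -, -, hx, hy⟩ := (hasEigenPair_iff ρ a b).mp h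
  obtain ⟨P, z, hz, hXP, hYP⟩ := Matrix.exists_normalForm (Matrix.SpecialLinearGroup.det_coe _)
    (Matrix.SpecialLinearGroup.det_coe _) (rootExp_ne_zero a p) (rootExp_ne_inv ha hap) hx hy
    fun v hv c d h1 h2 => ρ.no_common_eigenvector hv h1 h2
  refine ⟨⟨z, hz⟩, P, fun g => ?_⟩
  have key : ρ.1 = (MulAut.conj P).toMonoidHom.comp (torusFamily ha hap hb hbq hab ⟨z, hz⟩).1 := by
    apply TorusKnotGroup.hom_ext
    · change _ = P * (torusFamily ha hap hb hbq hab ⟨z, hz⟩).1 (torusX p q) * P⁻¹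
      rw [torusFamily_torusX, eq_mul_inv_iff_mul_eq]
      exact Subtype.ext hXP
    · change _ = P * (torusFamily ha hap hb hbq hab ⟨z, hz⟩).1 (torusY p q) * P⁻¹
      rw [torusFamily_torusY, eq_mul_inv_iff_mul_eq]
      exact Subtype.ext hYP
  exact DFunLike.congr_fun key g

end Family

/-- The locally constant traces separate different pairs. Two classes with the same pair both lie in
the image of the family over the connected parameter space. -/
theorem mem_connectedComponent_iff {p q : ℕ} (hp : 0 < p) (hq : 0 < q)
    {ρ σ : IrrepSL2 (TorusKnotGroup p q)} {a b c d : ℕ} (h : HasEigenPair ρ a b)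
    (k : HasEigenPair σ c d) :
    (⟦ρ⟧ : IrrepClass (TorusKnotGroup p q)) ∈
        connectedComponent (⟦σ⟧ : IrrepClass (TorusKnotGroup p q)) ↔ a = c ∧ b = d := by
  constructor
  · intro hc
    have h1 := (isLocallyConstant_classTrace hp hq).apply_eq_of_isPreconnected
      isPreconnected_connectedComponent hc mem_connectedComponent
    exact h.eq_of_trace_eq k (congrArg Prod.fst h1) (congrArg Prod.snd h1)
  · rintro ⟨rfl, rfl⟩
    obtain ⟨hab, -⟩ := h.modEq_and_pow hp hq
    obtain ⟨ha, hap, hb, hbq, -⟩ := (hasEigenPair_iff ρ a b).mp h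
    obtain ⟨z, hz⟩ := h.exists_torusFamily_equiv ha hap hb hbq hab
    obtain ⟨w, hw⟩ := k.exists_torusFamily_equiv ha hap hb hbq hab
    have : PreconnectedSpace {z : ℂ // z * (rootExp b q + (rootExp b q)⁻¹ - z) - 1 ≠ 0} :=
      Subtype.preconnectedSpace
      (isConnected_normalForm (rootExp b q) (rootExp_ne_zero b q)).isPreconnected
    have hc : IsPreconnected (Set.range fun z =>
        (⟦torusFamily ha hap hb hbq hab z⟧ : IrrepClass (TorusKnotGroup p q))) :=
      isPreconnected_range (continuous_quotient_mk'.comp (continuous_torusFamily ha hap hb hbq hab))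
    exact hc.subset_connectedComponent ⟨w, (Quotient.sound hw).symm⟩ ⟨z, (Quotient.sound hz).symm⟩

theorem mainTheorem5 (p q : ℕ) (hp : 0 < p) (hq : 0 < q) (hpq : p.Coprime q) :
    -- every irreducible representation has exactly one pair `(a, b)`; the twisted Alexander
    -- polynomial is given by the formula, whichever column `k` is removed
    (∀ ρ : IrrepSL2 (TorusKnotGroup p q),
      (∃! ab : ℕ × ℕ, HasEigenPair ρ ab.1 ab.2) ∧
      ∀ a b : ℕ, HasEigenPair ρ a b →
        a ≡ b [MOD 2] ∧
        (∀ k : Fin 2, wadaDenominator (torusAb p q) ρ.1 k ≠ 0 ∧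
          wadaQuotient (torusAb p q) ρ.1 k = torusFormula p q (rootExp a p) (rootExp b q)) ∧
        twistedAlexander (torusAb p q) ρ.1 = torusFormula p q (rootExp a p) (rootExp b q)) ∧
    -- the pairs `(a, b)` with `a ≡ b` mod 2 index the connected components
    (∀ a b : ℕ, 0 < a → a < p → 0 < b → b < q → a ≡ b [MOD 2] →
      ∃ ρ : IrrepSL2 (TorusKnotGroup p q), HasEigenPair ρ a b) ∧
    (∀ (ρ σ : IrrepSL2 (TorusKnotGroup p q)) (a b c d : ℕ),
      HasEigenPair ρ a b → HasEigenPair σ c d →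
      ((⟦ρ⟧ : IrrepClass (TorusKnotGroup p q)) ∈
          connectedComponent (⟦σ⟧ : IrrepClass (TorusKnotGroup p q)) ↔ a = c ∧ b = d)) ∧
    -- the twisted Alexander polynomial is a function on the space of conjugacy classes, which is
    -- locally constant and constant on each connected component
    ∃ Δ : IrrepClass (TorusKnotGroup p q) → FractionRing (LaurentPolynomial ℂ),
      (∀ ρ : IrrepSL2 (TorusKnotGroup p q), Δ ⟦ρ⟧ = twistedAlexander (torusAb p q) ρ.1) ∧
      IsLocallyConstant Δ ∧
      ∀ c d : IrrepClass (TorusKnotGroup p q), c ∈ connectedComponent d → Δ c = Δ d := by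
  refine ⟨fun ρ => ⟨existsUnique_hasEigenPair ρ hp hq, fun a b h =>
      ⟨(h.modEq_and_pow hp hq).1, h.wadaQuotient_eq hp hq, h.twistedAlexander_eq hp hq⟩⟩,
    fun a b => exists_hasEigenPair_of_modEq,
    fun ρ σ a b c d => mem_connectedComponent_iff hp hq,
    classTwistedAlexander hp hq, fun ρ => rfl, isLocallyConstant_classTwistedAlexander hp hq,
    fun c d h => ?_⟩
  exact (isLocallyConstant_classTwistedAlexander hp hq).apply_eq_of_isPreconnected
    isPreconnected_connectedComponent h mem_connectedComponent
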